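/- Let $n\ge 2$ and $m\ge 1$, let $F_n$ and $F_m$ be free groups of ranks $n$ and $m$, and let $w_1\in F_n$ and $w_2\in F_m$ be either both non-trivial or both trivial (that is, $w_1\mapsto w_2$ defines an isomorphism $\langle w_1\rangle\to\langle w_2\rangle$). Let $G=F_n *_{w_1=w_2} F_m$ be the free product of $F_n$ and $F_m$ amalgamated along the cyclic subgroups $\langle w_1\rangle$ and $\langle w_2\rangle$ via $w_1\mapsto w_2$. A left order on $G$ is a total order $\preceq$ on $G$ such that $f\preceq h$ implies $gf\preceq gh$ for all $f,g,h\in G$. Let $\mathcal{LO}(G)$ be the set of all left orders on $G$, with the topology generated by the sets $\{\preceq\;\mid 1\prec g\}$, $g\in G$. Then $\mathcal{LO}(G)$ has no isolated points. Moreover, $\mathcal{LO}(G)$ is compact, metrizable and totally disconnected, and it is homeomorphic to the Cantor set (in particular, it is non-empty). -/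

import Mathlib

/-- A left order on a group `G`: a total order relation that is invariant under left
multiplication. -/
@[ext]
structure LeftOrder (G : Type*) [Group G] where
  /-- The relation `a ≼ b`. -/
  le : G → G → Prop
  le_refl : ∀ a, le a a
  le_trans : ∀ a b c, le a b → le b c → le a c
  le_antisymm : ∀ a b, le a b → le b a → a = b
  le_total : ∀ a b, le a b ∨ le b a
  mul_le_mul_left : ∀ g a b, le a b → le (g * a) (g * b)

/-- The strict relation `a ≺ b` of a left order. -/
def LeftOrder.lt {G : Type*} [Group G] (P : LeftOrder G) (a b : G) : Prop :=
  P.le a b ∧ a ≠ b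

/-- The topology on the space of left orders of `G`: the sets `{P | 1 ≺ g}`, for `g` in `G`, form
a subbase, so the sets of left orders for which finitely many given `P`-positive elements are
positive form a local base at `P`. -/
instance LeftOrder.instTopologicalSpace {G : Type*} [Group G] : TopologicalSpace (LeftOrder G) :=
  TopologicalSpace.generateFrom {U | ∃ g : G, U = {P : LeftOrder G | P.lt 1 g}}

/-- The two homomorphisms from the infinite cyclic group sending its generator to `w₁` in the free
group of rank `n` and to `w₂` in the free group of rank `m`. -/
def cyclicMaps {n m : ℕ} (w₁ : FreeGroup (Fin n)) (w₂ : FreeGroup (Fin m)) :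
    (b : Bool) → Multiplicative ℤ →* FreeGroup (Fin (bif b then m else n))
  | false => zpowersHom (FreeGroup (Fin n)) w₁
  | true => zpowersHom (FreeGroup (Fin m)) w₂

/-- The group `F_n *_{w₁ = w₂} F_m`: the pushout of the free groups of ranks `n` and `m` that
identifies `w₁` with `w₂`. It is the amalgamated free product along the cyclic subgroups generated
by `w₁` and `w₂` when these are isomorphic via `w₁ ↦ w₂`. -/
abbrev FreeAmalgam {n m : ℕ} (w₁ : FreeGroup (Fin n)) (w₂ : FreeGroup (Fin m)) : Type :=
  Monoid.PushoutI (cyclicMaps w₁ w₂)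

/-!
Left orders on a countable group `G` are studied through actions of `G` on the rational line: a left
order is induced by an action on `ℚ` and a base point (`LeftOrder.exists_action`), and an action
with a base point gives back a left order, ties being broken by a given one (`LeftOrder.ofAction`).
In this language, the positivity of finitely many elements, each moving the base point up, depends
only on the action on a bounded part of the line.

*No isolated points.* Let `G` be the amalgam of two free groups along nontrivial elements, with `w`
the amalgamated element, and let `M` be a point that `w` moves up, beyond the part of the line
relevant for finitely many given positive elements. As the two groups are free, their actions can
separately be changed above `M` by changing the generators one at a time. Writing `w` as a
cyclically reduced word, the points that `M` visits under the successive letters of the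
powers of `w` can be led, from some record on, along any prescribed model action (`exists_blend`,
`CyclicReading.exists_modification`). If the two free groups are modified so that the powers of `w`
have the same behaviour near `+∞`, the resulting two automorphisms are conjugate by an automorphism
fixing everything below `M` (`exists_conj_of_eq_below`), so that after conjugating one of the
actions they fit together to an action of `G` (`IsAmalgam.exists_modified`). Two models are used, up
to replacing `w` by its inverse.
* If the powers of neither `w` nor `w⁻¹` push an element above all others, the model is an action in
  which `w` is a translation; in the new left order the powers of `w` do so
  (`CyclicReading.exists_cofinal`, `IsAmalgam.exists_cofinal_order`).
* If the powers of `w` push some element above all others, the model is an action on `ℤ ×ₗ ℚ` in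
  which `w` preserves the fibers, translating each of them, while some generator moves the fibers
  up. It exists because a free group of rank at least two has a nontrivial homomorphism to `ℤ`
  vanishing on `w`. In the new left order the powers of `w` no longer push that element above all
  others (`CyclicReading.exists_fibered`, `IsAmalgam.exists_not_cofinal_order`).

In both cases the new left order differs from the old one (`IsAmalgam.exists_ne_of_finset`). If the
amalgamated elements are trivial, the group is free, hence the amalgam of itself with an infinite
cyclic group along a generator (`isAmalgam_mulEquiv_freeGroup`).

*Existence.* Each of the free groups acts freely on `ℚ` with `w` acting as `x ↦ x + 1`
(`FreeGroup.exists_free_hom_eq_shiftQ`). Conjugating these actions by automorphisms commuting with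
`x ↦ x + 1` gives many actions of the amalgam, and for a given nontrivial normal form a suitable
choice of these automorphisms makes it act nontrivially (`exists_twist_separating`). Comparing the
elements of the amalgam in countably many actions lexicographically gives a left order
(`LeftOrder.nonempty_of_residual`).

*Topology.* The signs of the elements of a countable group embed its space of left orders as a
closed subset of `ℕ → Bool` (`LeftOrder.isClosedEmbedding_code`), and a nonempty closed subset of
`ℕ → Bool` without isolated points is homeomorphic to `ℕ → Bool`
(`nonempty_homeomorph_of_perfect`).
-/


/-! ### Gluing order automorphisms of the rationals -/

/-- Two order automorphisms of `ℚ` can be interpolated: the first one on a lower ray, the second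
one on an upper ray. -/
theorem exists_glue (g h : ℚ ≃o ℚ) {α β : ℚ} (hαβ : α < β) (hgh : g α < h β) :
    ∃ k : ℚ ≃o ℚ, (∀ x ≤ α, k x = g x) ∧ ∀ x, β ≤ x → k x = h x := by
  set c : ℚ := (h β - g α) / (β - α) with hc
  have hba : 0 < β - α := sub_pos.2 hαβ
  have hc0 : 0 < c := div_pos (sub_pos.2 hgh) hba
  have hcβ : g α + (β - α) * c = h β := by rw [hc]; field_simp; ring
  let f : ℚ → ℚ := fun x => if x ≤ α then g x else if x < β then g α + (x - α) * c else h x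
  have f1 : ∀ x ≤ α, f x = g x := fun x hx => if_pos hx
  have f2 : ∀ x, α < x → x < β → f x = g α + (x - α) * c := fun x h1 h2 => by
    simp only [f]; rw [if_neg (not_le.2 h1), if_pos h2]
  have f3 : ∀ x, β ≤ x → f x = h x := fun x h1 => by
    simp only [f]; rw [if_neg (not_le.2 (hαβ.trans_le h1)), if_neg (not_lt.2 h1)]
  have hmono : StrictMono f := by
    intro x y hxy
    rcases le_or_gt y α with hy | hy
    · rw [f1 x (hxy.le.trans hy), f1 y hy]; exact g.strictMono hxy
    rcases le_or_gt β x with hx | hx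
    · rw [f3 x hx, f3 y (hx.trans hxy.le)]; exact h.strictMono hxy
    have hxle : f x ≤ g α + (max x α - α) * c := by
      rcases le_or_gt x α with hx' | hx'
      · rw [f1 x hx', max_eq_right hx']; simpa using g.monotone hx'
      · rw [f2 x hx' hx, max_eq_left hx'.le]
    have hyge : g α + (min y β - α) * c ≤ f y := by
      rcases le_or_gt β y with hy' | hy'
      · rw [f3 y hy', min_eq_right hy', hcβ]; exact h.monotone hy'
      · rw [f2 y hy hy', min_eq_left hy'.le]
    have : max x α < min y β := by simp [hxy, hy, hx, hαβ]
    have := mul_lt_mul_of_pos_right (sub_lt_sub_right this α) hc0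
    linarith
  have hsurj : Function.Surjective f := by
    intro y
    rcases le_or_gt y (g α) with hy | hy
    · refine ⟨g.symm y, ?_⟩
      rw [f1 _ (by rwa [OrderIso.symm_apply_le]), g.apply_symm_apply]
    rcases le_or_gt (h β) y with hy' | hy'
    · refine ⟨h.symm y, ?_⟩
      rw [f3 _ (by rwa [OrderIso.le_symm_apply]), h.apply_symm_apply]
    · refine ⟨α + (y - g α) / c, ?_⟩
      have h1 : 0 < (y - g α) / c := div_pos (sub_pos.2 hy) hc0
      have h2 : (y - g α) / c < β - α := by rw [div_lt_iff₀ hc0]; linarith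
      rw [f2 _ (by linarith) (by linarith)]
      field_simp
      ring
  refine ⟨hmono.orderIsoOfSurjective f hsurj, fun x hx => ?_, fun x hx => ?_⟩
  · exact f1 x hx
  · exact f3 x hx

/-- Interpolation of two order automorphisms of `ℚ` with finitely many prescribed values in
between. -/
theorem exists_glue_list (h : ℚ ≃o ℚ) (β : ℚ) (L : List (ℚ × ℚ)) :
    ∀ (g : ℚ ≃o ℚ) (α : ℚ),
      List.IsChain (fun p q : ℚ × ℚ => p.1 < q.1 ∧ p.2 < q.2) ((α, g α) :: (L ++ [(β, h β)])) →
      ∃ k : ℚ ≃o ℚ, (∀ x ≤ α, k x = g x) ∧ (∀ p ∈ L, k p.1 = p.2) ∧ ∀ x, β ≤ x → k x = h x := by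
  induction L with
  | nil =>
    intro g α hch
    simp only [List.nil_append, List.isChain_cons_cons, List.isChain_singleton, and_true] at hch
    obtain ⟨k, h1, h2⟩ := exists_glue g h hch.1 hch.2
    exact ⟨k, h1, by simp, h2⟩
  | cons p L ih =>
    intro g α hch
    rw [List.cons_append, List.isChain_cons_cons] at hch
    obtain ⟨⟨h1, h2⟩, hch⟩ := hch
    obtain ⟨g', hg1, hg2⟩ := exists_glue g (OrderIso.addRight (p.2 - p.1)) h1
      (by simpa using h2)
    have hp : g' p.1 = p.2 := by rw [hg2 _ le_rfl]; simp
    obtain ⟨k, k1, k2, k3⟩ := ih g' p.1 (by rw [hp]; exact hch)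
    refine ⟨k, fun x hx => ?_, ?_, k3⟩
    · rw [k1 x (hx.trans h1.le), hg1 x hx]
    · intro q hq
      rcases List.mem_cons.1 hq with rfl | hq
      · rw [k1 _ le_rfl, hp]
      · exact k2 q hq

/-- Automorphisms `p k` of `ℚ` whose restrictions to `[0, 1)` have adjacent images covering `ℚ`
combine to one automorphism of `ℚ`. -/
theorem exists_piecewise (p : ℤ → ℚ ≃o ℚ) (hp : ∀ k, p k 1 = p (k + 1) 0)
    (hbot : ∀ y, ∃ k, p k 0 ≤ y) (htop : ∀ y, ∃ k, y < p k 0) :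
    ∃ u : ℚ ≃o ℚ, ∀ x, u x = p ⌊x⌋ (Int.fract x) := by
  have he : StrictMono fun k => p k 0 := by
    refine strictMono_int_of_lt_succ fun k => ?_
    simp only [← hp]
    exact (p k).strictMono one_pos
  let f : ℚ → ℚ := fun x => p ⌊x⌋ (Int.fract x)
  have hmono : StrictMono f := by
    intro x y hxy
    rcases (Int.floor_mono hxy.le).eq_or_lt with h | h
    · have : Int.fract x < Int.fract y := by
        rw [Int.fract, Int.fract, h]; linarith
      simp only [f]
      rw [h]
      exact (p _).strictMono this
    · calc f x < p ⌊x⌋ 1 := (p _).strictMono (Int.fract_lt_one x)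
        _ = p (⌊x⌋ + 1) 0 := hp _
        _ ≤ p ⌊y⌋ 0 := he.monotone h
        _ ≤ f y := (p _).monotone (Int.fract_nonneg y)
  have hsurj : Function.Surjective f := by
    intro y
    obtain ⟨b, hb⟩ := htop y
    obtain ⟨k, hk1, hk2⟩ := Int.exists_greatest_of_bdd (P := fun k => p k 0 ≤ y)
      ⟨b, fun z hz => he.le_iff_le.1 (hz.trans hb.le)⟩ (hbot y)
    have hk3 : y < p k 1 := by
      by_contra hcon
      have := hk2 (k + 1) (by rw [← hp]; exact not_lt.1 hcon)
      omega
    set r := (p k).symm y with hr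
    have h0 : 0 ≤ r := by rw [hr, OrderIso.le_symm_apply]; exact hk1
    have h1 : r < 1 := by rw [hr, OrderIso.symm_apply_lt]; exact hk3
    have hfl : ⌊(k : ℚ) + r⌋ = k := by
      rw [Int.floor_eq_iff]; constructor <;> linarith
    refine ⟨k + r, ?_⟩
    simp only [f, Int.fract, hfl]
    rw [add_sub_cancel_left, hr, OrderIso.apply_symm_apply]
  exact ⟨hmono.orderIsoOfSurjective f hsurj, fun x => rfl⟩

/-- A strictly increasing sequence `e : ℤ → ℚ`, unbounded in both directions, is the restriction
to `ℤ` of an automorphism of `ℚ`. -/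
theorem exists_orderIso_int (e : ℤ → ℚ) (he : ∀ k, e k < e (k + 1))
    (hbot : ∀ y, ∃ k, e k ≤ y) (htop : ∀ y, ∃ k, y < e k) :
    ∃ u : ℚ ≃o ℚ, ∀ k : ℤ, u k = e k := by
  have hpos : ∀ k, 0 < e (k + 1) - e k := fun k => sub_pos.2 (he k)
  let p : ℤ → ℚ ≃o ℚ := fun k =>
    (OrderIso.mulRight₀ (e (k + 1) - e k) (hpos k)).trans (OrderIso.addRight (e k))
  have hp : ∀ k x, p k x = x * (e (k + 1) - e k) + e k := fun k x => rfl
  obtain ⟨u, hu⟩ := exists_piecewise p (fun k => by rw [hp, hp]; ring)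
    (fun y => by simpa [hp] using hbot y) (fun y => by simpa [hp] using htop y)
  exact ⟨u, fun k => by rw [hu, hp]; simp⟩

/-- The translation `x ↦ x + 1` of `ℚ`. -/
def shiftQ : ℚ ≃o ℚ := OrderIso.addRight 1

@[simp] theorem shiftQ_apply (x : ℚ) : shiftQ x = x + 1 := rfl

theorem shiftQ_zpow_apply (k : ℤ) (x : ℚ) : (shiftQ ^ k) x = x + k := by
  induction k using Int.induction_on generalizing x with
  | zero => simp
  | succ k ih => rw [zpow_add_one, RelIso.mul_apply, shiftQ_apply, ih]; push_cast; ring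
  | pred k ih =>
    have h : shiftQ⁻¹ x = x - 1 := by
      rw [← sub_add_cancel x 1, ← shiftQ_apply, RelIso.inv_apply_self, shiftQ_apply]; ring
    rw [zpow_sub_one, RelIso.mul_apply, h, ih]; push_cast; ring

/-- An automorphism of `ℚ` moving `0` up, with the orbit of `0` unbounded in both directions, is
conjugate to `x ↦ x + 1`. -/
theorem exists_conj_shiftQ (f : ℚ ≃o ℚ) (h0 : 0 < f 0) (hbot : ∀ y, ∃ k : ℤ, (f ^ k) 0 ≤ y)
    (htop : ∀ y, ∃ k : ℤ, y < (f ^ k) 0) : ∃ u : ℚ ≃o ℚ, u⁻¹ * f * u = shiftQ := by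
  let p : ℤ → ℚ ≃o ℚ := fun k => (OrderIso.mulRight₀ (f 0) h0).trans (f ^ k)
  have hp : ∀ k x, p k x = (f ^ k) (x * f 0) := fun k x => rfl
  obtain ⟨u, hu⟩ := exists_piecewise p
    (fun k => by rw [hp, hp, zpow_add_one, RelIso.mul_apply]; simp)
    (fun y => by simpa [hp] using hbot y) (fun y => by simpa [hp] using htop y)
  refine ⟨u, ?_⟩
  rw [mul_assoc, inv_mul_eq_iff_eq_mul]
  ext x
  rw [RelIso.mul_apply, RelIso.mul_apply, shiftQ_apply, hu, hu, Int.floor_add_one,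
    Int.fract_add_one, hp, hp, add_comm, zpow_add, RelIso.mul_apply, zpow_one]

/-! ### Cyclically reduced words read letter by letter -/

/-- The value of a signed letter `(a, b)` under an assignment `f` of group elements to letters:
`f a` if `b` is true, and `(f a)⁻¹` otherwise. -/
def letter {α H : Type*} [Group H] (f : α → H) (x : α × Bool) : H :=
  cond x.2 (f x.1) (f x.1)⁻¹

/-- The product `letter f (s (n - 1)) * ⋯ * letter f (s 1) * letter f (s 0)` of the first `n`
letters of the sequence `s`; the letter `s 0` acts first. -/
def walk {α H : Type*} [Group H] (f : α → H) (s : ℤ → α × Bool) : ℕ → H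
  | 0 => 1
  | n + 1 => letter f (s n) * walk f s n

theorem map_letter {α H K : Type*} [Group H] [Group K] (F : H →* K) (f : α → H) (x : α × Bool) :
    F (letter f x) = letter (F ∘ f) x := by
  obtain ⟨a, b⟩ := x
  cases b <;> simp [letter]

theorem map_walk {α H K : Type*} [Group H] [Group K] (F : H →* K) (f : α → H)
    (s : ℤ → α × Bool) (n : ℕ) : F (walk f s n) = walk (F ∘ f) s n := by
  induction n with
  | zero => simp [walk]
  | succ n ih => rw [walk, map_mul, ih, map_letter, walk]

theorem letter_conj {α H : Type*} [Group H] (f : α → H) (u : H) (x : α × Bool) :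
    letter (fun a => u * f a * u⁻¹) x = u * letter f x * u⁻¹ := by
  obtain ⟨a, b⟩ := x
  cases b <;> simp [letter, mul_assoc]

/-- The bi-infinite sequence `s` of letters is reduced, has period `l > 0`, and spells the element
`c` of the free group over each period, from right to left. -/
structure CyclicReading {α : Type*} (c : FreeGroup α) (l : ℕ) (s : ℤ → α × Bool) : Prop where
  pos : 0 < l
  periodic : ∀ k, s (k + l) = s k
  reduced : ∀ k, s (k + 1) ≠ ((s k).1, !(s k).2)
  spells : walk FreeGroup.of s l = c

theorem CyclicReading.lift_eq {α H : Type*} [Group H] {c : FreeGroup α} {l : ℕ}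
    {s : ℤ → α × Bool} (hs : CyclicReading c l s) (f : α → H) :
    FreeGroup.lift f c = walk f s l := by
  rw [← hs.spells, map_walk]
  congr 1
  ext a
  simp

theorem CyclicReading.walk_add {α H : Type*} [Group H] {c : FreeGroup α} {l : ℕ}
    {s : ℤ → α × Bool} (hs : CyclicReading c l s) (f : α → H) (n : ℕ) :
    walk f s (n + l) = walk f s n * walk f s l := by
  induction n with
  | zero => simp [walk]
  | succ n ih =>
    rw [Nat.succ_add, walk, ih, walk, mul_assoc]
    push_cast
    rw [hs.periodic]

theorem CyclicReading.walk_mul {α H : Type*} [Group H] {c : FreeGroup α} {l : ℕ}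
    {s : ℤ → α × Bool} (hs : CyclicReading c l s) (f : α → H) (n : ℕ) :
    walk f s (n * l) = FreeGroup.lift f c ^ n := by
  induction n with
  | zero => simp [walk]
  | succ n ih => rw [Nat.succ_mul, hs.walk_add, ih, hs.lift_eq, pow_succ]

/-- Every nontrivial element of a free group is conjugate to one that can be read cyclically. -/
theorem exists_cyclicReading {α : Type*} (w : FreeGroup α) (hw : w ≠ 1) :
    ∃ (u c : FreeGroup α) (l : ℕ) (s : ℤ → α × Bool),
      w = u * c * u⁻¹ ∧ CyclicReading c l s := by
  classical
  set L := FreeGroup.reduceCyclically w.toWord with hL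
  set U := FreeGroup.reduceCyclically.conjugator w.toWord with hU
  have hwL : w = FreeGroup.mk U * FreeGroup.mk L * (FreeGroup.mk U)⁻¹ := by
    rw [FreeGroup.inv_mk, FreeGroup.mul_mk, FreeGroup.mul_mk,
      FreeGroup.reduceCyclically.conj_conjugator_reduceCyclically, FreeGroup.mk_toWord]
  have hcyc : FreeGroup.IsCyclicallyReduced L :=
    FreeGroup.reduceCyclically.isCyclicallyReduced FreeGroup.isReduced_toWord
  have hLne : L ≠ [] := by
    intro h
    rw [h, ← FreeGroup.one_eq_mk] at hwL
    exact hw (by rw [hwL, mul_one, mul_inv_cancel])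
  have hl : 0 < L.length := List.length_pos_iff.2 hLne
  have hl' : (0 : ℤ) < L.length := by exact_mod_cast hl
  have hidx : ∀ k : ℤ, L.length - 1 - (k % L.length).toNat < L.length := fun k => by omega
  let s : ℤ → α × Bool := fun k => L[L.length - 1 - (k % L.length).toNat]'(hidx k)
  refine ⟨_, FreeGroup.mk L, L.length, s, hwL, hl, fun k => ?_, fun k => ?_, ?_⟩
  · simp [s]
  · have h0 := Int.emod_nonneg k hl'.ne'
    have h1 := Int.emod_lt_of_pos k hl'
    intro hcon
    rcases eq_or_ne (k % L.length) (L.length - 1) with h | h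
    · have h2 : (k + 1) % L.length = 0 := by
        rw [Int.add_emod, h, Int.add_emod_emod]
        simp
      have e1 : s k = L.head hLne := by
        simp only [s]
        rw [List.head_eq_getElem]
        congr 1
        omega
      have e2 : s (k + 1) = L.getLast hLne := by
        simp only [s]
        rw [List.getLast_eq_getElem]
        congr 1
        omega
      have := hcyc.2 _ (List.getLast_mem_getLast? hLne) _ (List.head_mem_head? hLne)
      rw [← e1, ← e2, hcon] at this
      simp at this
    · have h2 : (k + 1) % L.length = k % L.length + 1 := by
        rw [Int.add_emod]
        rcases eq_or_ne (L.length : ℤ) 1 with h3 | h3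
        · omega
        rw [Int.emod_eq_of_lt (a := 1) (by omega) (by omega),
          Int.emod_eq_of_lt (by omega) (by omega)]
      have hch := List.isChain_iff_getElem.1 hcyc.1 (L.length - 1 - ((k + 1) % L.length).toNat)
        (by omega)
      have e1 : s k = L[L.length - 1 - ((k + 1) % L.length).toNat + 1]'(by omega) := by
        simp only [s]
        congr 1
        omega
      have e2 : s (k + 1) = L[L.length - 1 - ((k + 1) % L.length).toNat]'(hidx _) := rfl
      rw [← e1, ← e2, hcon] at hch
      simp at hch
  · have key : ∀ n ≤ L.length, walk FreeGroup.of s n = FreeGroup.mk (L.drop (L.length - n)) := by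
      intro n
      induction n with
      | zero => intro _; simp [walk, FreeGroup.one_eq_mk]
      | succ n ih =>
        intro hn
        rw [walk, ih (by omega)]
        have e1 : s n = L[L.length - (n + 1)]'(by omega) := by
          simp only [s]
          congr 1
          rw [Int.emod_eq_of_lt (by omega) (by omega)]
          omega
        rw [List.drop_eq_getElem_cons (i := L.length - (n + 1)) (by omega), ← e1,
          show L.length - (n + 1) + 1 = L.length - n by omega]
        obtain ⟨a, b⟩ := s n
        cases b <;> simp [letter, FreeGroup.of, FreeGroup.invRev]
    rw [key _ le_rfl]
    simp

/-! ### Actions of free groups in which a given element is a translation -/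

/-- A reduced bi-infinite word acts on `ℚ` so that each of its letters moves one step to the right:
the letter `s k` sends `k` to `k + 1`. Reducedness makes the prescribed values monotone. -/
theorem exists_chain_action {α : Type*} (s : ℤ → α × Bool)
    (hs : ∀ k, s (k + 1) ≠ ((s k).1, !(s k).2)) :
    ∃ σ : α → ℚ ≃o ℚ, ∀ k : ℤ, letter σ (s k) (k : ℚ) = k + 1 := by
  classical
  -- The displacements `±1` are forced; `±1 / 3` keeps the neighbouring values in order.
  let δ : α → ℤ → ℚ := fun a k =>
    if s k = (a, true) then 1 else if s (k - 1) = (a, false) then -1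
    else if s (k - 1) = (a, true) then 1 / 3 else if s k = (a, false) then -1 / 3 else 0
  have hδ : ∀ a k, |δ a k| ≤ 1 := by
    intro a k
    simp only [δ]
    split_ifs <;> norm_num [abs_le]
  have hstep : ∀ a (k : ℤ), (k : ℚ) + δ a k < ((k + 1 : ℤ) : ℚ) + δ a (k + 1) := by
    intro a k
    have h1 := hs k
    have h2 := hs (k - 1)
    simp only [sub_add_cancel] at h2
    suffices δ a k - 1 < δ a (k + 1) by push_cast; linarith
    simp only [δ, add_sub_cancel_right]
    split_ifs <;> first | (norm_num; done) | (exfalso; simp_all)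
  have hex : ∀ a, ∃ u : ℚ ≃o ℚ, ∀ k : ℤ, u k = k + δ a k := by
    intro a
    refine exists_orderIso_int (fun k => k + δ a k) (hstep a) (fun y => ?_) (fun y => ?_)
    · obtain ⟨n, hn⟩ := exists_int_lt (y - 1)
      exact ⟨n, by have := (abs_le.1 (hδ a n)).2; linarith⟩
    · obtain ⟨n, hn⟩ := exists_int_gt (y + 1)
      exact ⟨n, by have := (abs_le.1 (hδ a n)).1; linarith⟩
  choose σ hσ using hex
  refine ⟨σ, fun k => ?_⟩
  rcases hsk : s k with ⟨a, b⟩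
  cases b
  · have h1 : δ a (k + 1) = -1 := by
      have := hs k
      simp only [δ, add_sub_cancel_right]
      rw [if_neg (by rw [hsk] at this; simpa using this), if_pos hsk]
    have h2 := hσ a (k + 1)
    rw [h1] at h2
    push_cast at h2
    simp only [letter, cond_false]
    rw [show (k : ℚ) = σ a (k + 1) by rw [h2]; ring, RelIso.inv_apply_self, h2]
    ring
  · simp only [letter, cond_true]
    rw [hσ]
    simp [δ, hsk]

theorem walk_apply_of_chain {α : Type*} {τ : α → ℚ ≃o ℚ} {s : ℤ → α × Bool} {y : ℤ → ℚ}
    (hy : ∀ k, letter τ (s k) (y k) = y (k + 1)) (n : ℕ) : walk τ s n (y 0) = y n := by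
  induction n with
  | zero => simp [walk]
  | succ n ih => rw [walk, RelIso.mul_apply, ih, hy]; simp

/-- A cyclically reduced nontrivial element `c` of a free group acts on `ℚ` as the translation by
`1` in a suitable action, in which moreover the letters of the periodic word with period `c`
successively move a point to the right. -/
theorem CyclicReading.exists_translation {α : Type*} {c : FreeGroup α} {l : ℕ}
    {s : ℤ → α × Bool} (hs : CyclicReading c l s) :
    ∃ (τ : α → ℚ ≃o ℚ) (y : ℤ → ℚ), FreeGroup.lift τ c = shiftQ ∧ StrictMono y ∧
      ∀ k, letter τ (s k) (y k) = y (k + 1) := by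
  obtain ⟨σ, hσ⟩ := exists_chain_action s hs.reduced
  set W := FreeGroup.lift σ c with hW
  have hl : (0 : ℚ) < l := by exact_mod_cast hs.pos
  have hper : ∀ m k : ℤ, s (k + l * m) = s k := by
    intro m k
    induction m using Int.induction_on with
    | zero => simp
    | succ m ih => rw [mul_add, mul_one, ← add_assoc, hs.periodic, ih]
    | pred m ih => rw [← ih, ← hs.periodic (k + l * (-m - 1))]; congr 1; ring
  have hWm : ∀ m : ℤ, W ((l * m : ℤ) : ℚ) = ((l * (m + 1) : ℤ) : ℚ) := by
    intro m
    have := walk_apply_of_chain (τ := σ) (s := s) (y := fun k => ((k + l * m : ℤ) : ℚ))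
      (fun k => by
        have := hσ (k + l * m)
        rw [hper] at this
        rw [this]; push_cast; ring) l
    rw [hW, hs.lift_eq]
    simp only [zero_add] at this
    rw [this]
    push_cast
    ring
  have hWz : ∀ m : ℤ, (W ^ m) 0 = l * m := by
    intro m
    induction m using Int.induction_on with
    | zero => simp
    | succ m ih =>
      rw [add_comm, zpow_add, RelIso.mul_apply, ih, zpow_one]
      have := hWm m
      push_cast at this ⊢
      rw [this]; ring
    | pred m ih =>
      rw [sub_eq_add_neg, add_comm, zpow_add, RelIso.mul_apply, ih, zpow_neg_one]
      have := hWm (-m - 1)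
      push_cast at this ⊢
      rw [sub_add_cancel] at this
      rw [← this, RelIso.inv_apply_self]; ring
  obtain ⟨u, hu⟩ := exists_conj_shiftQ W
    (by have := hWz 1; rw [zpow_one] at this; rw [this]; simpa using hl)
    (fun y => by
      obtain ⟨n, hn⟩ := exists_int_lt (y / l)
      exact ⟨n, by rw [hWz, mul_comm]; exact ((lt_div_iff₀ hl).1 hn).le⟩)
    (fun y => by
      obtain ⟨n, hn⟩ := exists_int_gt (y / l)
      exact ⟨n, by rw [hWz, mul_comm]; exact (div_lt_iff₀ hl).1 hn⟩)
  refine ⟨fun a => u⁻¹ * σ a * u⁻¹⁻¹, fun k => u⁻¹ (k : ℚ), ?_, ?_, fun k => ?_⟩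
  · have : FreeGroup.lift (fun a => u⁻¹ * σ a * u⁻¹⁻¹) =
        (MulAut.conj u⁻¹).toMonoidHom.comp (FreeGroup.lift σ) := by
      ext1 a; simp
    rw [this, ← hu]
    simp [hW]
  · exact (u⁻¹).strictMono.comp Int.cast_strictMono
  · rw [letter_conj, inv_inv, RelIso.mul_apply, RelIso.mul_apply, RelIso.apply_inv_self, hσ]
    push_cast
    rfl

/-! ### Blending two actions along a chain -/

theorem letter_apply_eq_iff {α : Type*} (f : α → ℚ ≃o ℚ) (a : α) (b : Bool) (x y : ℚ) :
    letter f (a, b) x = y ↔ cond b (f a x = y) (f a y = x) := by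
  cases b
  · simp only [letter, cond_false]
    constructor
    · rintro rfl; exact RelIso.apply_inv_self _ _
    · rintro rfl; exact RelIso.inv_apply_self _ _
  · rfl

/-- The interpolation at one generator in the blending of two actions: `f` below `p` and `g` above
`q` are connected through the prescribed edges between `u < T < v`, where `A`, `A'`, `B` and
`B'` say which of the edges from `u` to `T`, from `T` to `u`, from `T` to `v` and from `v` to `T`
are prescribed. -/
theorem exists_blend_generator (f g : ℚ ≃o ℚ) {p q u T v : ℚ} (hup : u ≤ p) (hpT : p < T)
    (hTq : T < q) (hqv : q ≤ v) (A A' B B' : Prop) (hA : A → f u = T) (hA' : A' → f T = u)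
    (hB : B → g T = v) (hB' : B' → g v = T) (h1 : ¬ (A ∧ A')) (h2 : ¬ (A ∧ B')) (h3 : ¬ (A' ∧ B))
    (h4 : ¬ (B ∧ B')) :
    ∃ k : ℚ ≃o ℚ, (∀ x ≤ p, f x ≤ p ∨ k x ≤ p → k x = f x) ∧
      (∀ x, q ≤ x → q ≤ g x → k x = g x) ∧
      (A → k u = T) ∧ (A' → k T = u) ∧ (B → k T = v) ∧ (B' → k v = T) := by
  classical
  set α := min p (f.symm p) with hα
  set β := max q (g.symm q) with hβ
  have hα1 : α ≤ p := min_le_left _ _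
  have hα2 : f α ≤ p := by rw [← OrderIso.le_symm_apply]; exact min_le_right _ _
  have hβ1 : q ≤ β := le_max_left _ _
  have hβ2 : q ≤ g β := by rw [← OrderIso.symm_apply_le]; exact le_max_right _ _
  let L1 : List (ℚ × ℚ) := if A then [(u, T)] else if A' then [(T, u)] else []
  let L2 : List (ℚ × ℚ) := if B then [(T, v)] else if B' then [(v, T)] else []
  have hAα : A → α < u := fun h => f.lt_iff_lt.1 (by rw [hA h]; exact hα2.trans_lt hpT)
  have hAα' : A' → f α < u := fun h => by rw [← hA' h]; exact f.strictMono (hα1.trans_lt hpT)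
  have hBβ : B → v < g β := fun h => by rw [← hB h]; exact g.strictMono (hTq.trans_le hβ1)
  have hBβ' : B' → v < β := fun h => g.lt_iff_lt.1 (by rw [hB' h]; exact hTq.trans_le hβ2)
  obtain ⟨k, k1, k2, k3⟩ := exists_glue_list g β (L1 ++ L2) f α (by
    simp only [L1, L2]
    split_ifs <;>
      simp only [List.nil_append, List.append_nil, List.cons_append, List.isChain_cons_cons,
        List.isChain_singleton, and_true] <;>
      grind)
  refine ⟨k, fun x hx hfx => ?_, fun x hx hgx => k3 x ?_, fun h => ?_, fun h => ?_, fun h => ?_,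
    fun h => ?_⟩
  · by_cases hle : f x ≤ p
    · exact k1 x (le_min hx (by rwa [OrderIso.le_symm_apply]))
    · exfalso
      have h5 : f.symm p < x := by rw [OrderIso.symm_apply_lt]; exact not_le.1 hle
      have h6 : α = f.symm p := min_eq_right (h5.le.trans hx)
      have h7 : k α = p := by rw [k1 _ le_rfl, h6, OrderIso.apply_symm_apply]
      have h8 : k α < k x := k.strictMono (by rw [h6]; exact h5)
      rw [h7] at h8
      exact h8.not_ge (hfx.resolve_left hle)
  · exact max_le hx (by rwa [OrderIso.symm_apply_le])
  · exact k2 (u, T) (by simp [L1, h])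
  · exact k2 (T, u) (by simp [L1, h, show ¬ A from fun h' => h1 ⟨h', h⟩])
  · exact k2 (T, v) (by simp [L2, h])
  · exact k2 (v, T) (by simp [L2, h, show ¬ B from fun h' => h4 ⟨h', h⟩])

/-- Blending of two actions of a free group on `ℚ`. Let `t` be a sequence of points visited
successively under the letters of a reduced word, up to the index `j` in the action `f` and from the
index `j` on in the action `g`, with the points before `t j` lying below `p < t j` and those after
it above `q > t j`. There is an action in which the whole sequence is visited in this way, and which
agrees with `f` below `p` and with `g` above `q`. -/
theorem exists_blend {α : Type*} (f g : α → ℚ ≃o ℚ) (s : ℤ → α × Bool)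
    (hs : ∀ k, s (k + 1) ≠ ((s k).1, !(s k).2)) (t : ℕ → ℚ) {j : ℕ} (hj : 0 < j)
    (h1 : ∀ k : ℕ, k < j → letter f (s k) (t k) = t (k + 1))
    (h2 : ∀ k : ℕ, j ≤ k → letter g (s k) (t k) = t (k + 1)) {p q : ℚ} (hp : p < t j)
    (hq : t j < q) (ht1 : ∀ k < j, t k ≤ p) (ht2 : ∀ k, j < k → q ≤ t k) :
    ∃ f' : α → ℚ ≃o ℚ, (∀ k : ℕ, letter f' (s k) (t k) = t (k + 1)) ∧
      (∀ a, ∀ x ≤ p, f a x ≤ p ∨ f' a x ≤ p → f' a x = f a x) ∧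
      (∀ a x, q ≤ x → q ≤ g a x → f' a x = g a x) := by
  obtain ⟨i, rfl⟩ : ∃ i, j = i + 1 := ⟨j - 1, by omega⟩
  have hsi := hs i
  have key : ∀ a, ∃ k : ℚ ≃o ℚ, (∀ x ≤ p, f a x ≤ p ∨ k x ≤ p → k x = f a x) ∧
      (∀ x, q ≤ x → q ≤ g a x → k x = g a x) ∧
      (s i = (a, true) → k (t i) = t (i + 1)) ∧ (s i = (a, false) → k (t (i + 1)) = t i) ∧
      (s (i + 1) = (a, true) → k (t (i + 1)) = t (i + 1 + 1)) ∧
      (s (i + 1) = (a, false) → k (t (i + 1 + 1)) = t (i + 1)) := by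
    intro a
    have e1 := h1 i (by omega)
    have e2 := h2 (i + 1) le_rfl
    push_cast at e2
    apply exists_blend_generator (f a) (g a) (ht1 i (by omega)) hp hq (ht2 (i + 1 + 1) (by omega))
    · intro h; rw [h] at e1; exact (letter_apply_eq_iff _ _ _ _ _).1 e1
    · intro h; rw [h] at e1; exact (letter_apply_eq_iff _ _ _ _ _).1 e1
    · intro h; rw [h] at e2; exact (letter_apply_eq_iff _ _ _ _ _).1 e2
    · intro h; rw [h] at e2; exact (letter_apply_eq_iff _ _ _ _ _).1 e2
    · rintro ⟨h, h'⟩; simp [h] at h'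
    · rintro ⟨h, h'⟩; rw [h, h'] at hsi; simp at hsi
    · rintro ⟨h, h'⟩; rw [h, h'] at hsi; simp at hsi
    · rintro ⟨h, h'⟩; simp [h] at h'
  choose f' F1 F2 F3 F4 F5 F6 using key
  refine ⟨f', fun k => ?_, F1, F2⟩
  rcases hsk : s k with ⟨a, b⟩
  rw [letter_apply_eq_iff]
  rcases lt_trichotomy k i with hk | rfl | hk
  · have e1 := h1 k (by omega)
    rw [hsk, letter_apply_eq_iff] at e1
    have l1 := ht1 k (by omega)
    have l2 := ht1 (k + 1) (by omega)
    cases b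
    · simp only [cond_false] at e1 ⊢
      rw [F1 a _ l2 (Or.inl (by rwa [e1])), e1]
    · simp only [cond_true] at e1 ⊢
      rw [F1 a _ l1 (Or.inl (by rwa [e1])), e1]
  · cases b
    · exact F4 a hsk
    · exact F3 a hsk
  rcases eq_or_ne k (i + 1) with rfl | hk'
  · push_cast at hsk
    cases b
    · exact F6 a hsk
    · exact F5 a hsk
  · have e1 := h2 k (by omega)
    rw [hsk, letter_apply_eq_iff] at e1
    have l1 := ht2 k (by omega)
    have l2 := ht2 (k + 1) (by omega)
    cases b
    · simp only [cond_false] at e1 ⊢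
      rw [F2 a _ l2 (by rwa [e1]), e1]
    · simp only [cond_true] at e1 ⊢
      rw [F2 a _ l1 (by rwa [e1]), e1]

/-! ### Modifying an action of a free group above a point -/

/-- Two actions `f` and `f'` of a free group agree below `M`: a generator has the same effect in
both on each point of the ray `(-∞, M]` which one of them keeps in that ray. -/
def AgreeBelow {α : Type*} (M : ℚ) (f f' : α → ℚ ≃o ℚ) : Prop :=
  ∀ a, ∀ x ≤ M, f a x ≤ M ∨ f' a x ≤ M → f' a x = f a x

theorem AgreeBelow.mono {α : Type*} {M p : ℚ} {f f' : α → ℚ ≃o ℚ} (h : AgreeBelow p f f')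
    (hMp : M ≤ p) : AgreeBelow M f f' := fun a x hx hfx =>
  h a x (hx.trans hMp) (hfx.imp (fun h => h.trans hMp) (fun h => h.trans hMp))

theorem AgreeBelow.trans {α : Type*} {M : ℚ} {f f' f'' : α → ℚ ≃o ℚ} (h : AgreeBelow M f f')
    (h' : AgreeBelow M f' f'') : AgreeBelow M f f'' := by
  rintro a x hx (hfx | hfx)
  · have h1 := h a x hx (Or.inl hfx)
    rw [h' a x hx (Or.inl (by rwa [h1])), h1]
  · have h1 := h' a x hx (Or.inr hfx)
    rw [h1, h a x hx (Or.inr (by rwa [← h1]))]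

theorem AgreeBelow.letter_eq {α : Type*} {M : ℚ} {f f' : α → ℚ ≃o ℚ} (h : AgreeBelow M f f')
    (z : α × Bool) {x : ℚ} (hx : x ≤ M) (hz : letter f z x ≤ M ∨ letter f' z x ≤ M) :
    letter f' z x = letter f z x := by
  obtain ⟨a, b⟩ := z
  cases b
  · rcases hz with hz | hz
    · obtain ⟨y, hy⟩ : ∃ y, letter f (a, false) x = y := ⟨_, rfl⟩
      rw [hy] at hz ⊢
      rw [letter_apply_eq_iff, cond_false] at hy ⊢
      rw [h a y hz (Or.inl (by rwa [hy])), hy]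
    · obtain ⟨y, hy⟩ : ∃ y, letter f' (a, false) x = y := ⟨_, rfl⟩
      rw [hy] at hz ⊢
      symm
      rw [letter_apply_eq_iff, cond_false] at hy ⊢
      rw [← h a y hz (Or.inr (by rwa [hy])), hy]
  · exact h a x hx hz

theorem AgreeBelow.walk_eq {α : Type*} {M p : ℚ} {f f' : α → ℚ ≃o ℚ} (h : AgreeBelow p f f')
    {s : ℤ → α × Bool} {n : ℕ} (hn : ∀ k ≤ n, walk f s k M ≤ p) :
    ∀ k ≤ n, ∀ x ≤ M, walk f' s k x = walk f s k x := by
  intro k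
  induction k with
  | zero => intro _ x _; simp [walk]
  | succ k ih =>
    intro hk x hx
    have h1 : walk f s k x ≤ p := ((walk f s k).monotone hx).trans (hn k (by omega))
    have h2 : walk f s (k + 1) x ≤ p := ((walk f s (k + 1)).monotone hx).trans (hn (k + 1) hk)
    rw [walk, RelIso.mul_apply] at h2
    rw [walk, walk, RelIso.mul_apply, RelIso.mul_apply, ih (by omega) x hx]
    exact h.letter_eq _ h1 (Or.inl h2)

theorem letter_eq_of_upper {α : Type*} {q : ℚ} {f f' : α → ℚ ≃o ℚ}
    (h : ∀ a x, q ≤ x → q ≤ f a x → f' a x = f a x) (z : α × Bool) {x : ℚ} (hx : q ≤ x)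
    (hz : q ≤ letter f z x) : letter f' z x = letter f z x := by
  obtain ⟨a, b⟩ := z
  cases b
  · obtain ⟨y, hy⟩ : ∃ y, letter f (a, false) x = y := ⟨_, rfl⟩
    rw [hy] at hz ⊢
    rw [letter_apply_eq_iff, cond_false] at hy ⊢
    rw [h a y hz (by rwa [hy]), hy]
  · exact h a x hx hz

/-- Modification of an action beyond a record point of the orbit of `M` under the letters of the
periodic word: from that point on, the orbit is that of a given model action `g`. -/
theorem CyclicReading.exists_modification {α : Type*} {c : FreeGroup α} {l : ℕ}
    {s : ℤ → α × Bool} (hs : CyclicReading c l s) (f g : α → ℚ ≃o ℚ) (M : ℚ) {j : ℕ} (hlj : l < j)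
    (hrec : ∀ k < j, walk f s k M < walk f s j M) (z : ℕ → ℚ) (hzj : z j = walk f s j M)
    (hz : ∀ k : ℕ, j ≤ k → letter g (s k) (z k) = z (k + 1)) {q : ℚ} (hq : z j < q)
    (hzq : ∀ k, j < k → q ≤ z k) :
    ∃ f' : α → ℚ ≃o ℚ, AgreeBelow M f f' ∧
      (∀ x ≤ M, FreeGroup.lift f' c x = FreeGroup.lift f c x) ∧
      (∀ k ≤ j, walk f' s k M = walk f s k M) ∧ (∀ k, j ≤ k → walk f' s k M = z k) ∧
      (∀ a x, q ≤ x → q ≤ g a x → f' a x = g a x) := by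
  -- All points visited before the record lie below `p`.
  obtain ⟨i, hi, himax⟩ := Finset.exists_max_image (Finset.range j) (fun k => walk f s k M)
    ⟨0, by simp; omega⟩
  simp only [Finset.mem_range] at hi himax
  set p := walk f s i M with hp
  let t : ℕ → ℚ := fun k => if k ≤ j then walk f s k M else z k
  have ht1 : ∀ k ≤ j, t k = walk f s k M := fun k hk => if_pos hk
  have ht2 : ∀ k, j ≤ k → t k = z k := by
    intro k hk
    rcases hk.eq_or_lt with rfl | hk
    · rw [ht1 _ le_rfl, hzj]
    · exact if_neg (by omega)
  obtain ⟨f', F1, F2, F3⟩ := exists_blend f g s hs.reduced t (j := j) (p := p) (q := q) (by omega)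
    (fun k hk => by rw [ht1 k hk.le, ht1 (k + 1) hk, walk, RelIso.mul_apply])
    (fun k hk => by rw [ht2 k hk, ht2 (k + 1) (by omega), hz k hk])
    (by rw [ht1 j le_rfl]; exact hrec i hi) (by rw [ht2 j le_rfl]; exact hq)
    (fun k hk => by rw [ht1 k hk.le]; exact himax k hk)
    (fun k hk => by rw [ht2 k hk.le]; exact hzq k hk)
  have hA : AgreeBelow p f f' := F2
  have hMp : M ≤ p := by simpa [walk] using himax 0 (by omega)
  have hw : ∀ k, walk f' s k M = t k := by
    intro k
    induction k with
    | zero => rw [ht1 0 (by omega)]; simp [walk]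
    | succ k ih => rw [walk, RelIso.mul_apply, ih, F1]
  refine ⟨f', hA.mono hMp, fun x hx => ?_, fun k hk => ?_, fun k hk => ?_, F3⟩
  · rw [hs.lift_eq, hs.lift_eq]
    exact hA.walk_eq (fun k hk => himax k (by omega)) l le_rfl x hx
  · rw [hw, ht1 k hk]
  · rw [hw, ht2 k hk]

/-- If `c` moves `M` up, the orbit of `M` under the letters of the periodic word reaches a strict
record at some index greater than the period. -/
theorem CyclicReading.exists_record {α : Type*} {c : FreeGroup α} {l : ℕ}
    {s : ℤ → α × Bool} (hs : CyclicReading c l s) (f : α → ℚ ≃o ℚ) (M : ℚ)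
    (hM : M < FreeGroup.lift f c M) :
    ∃ j, l < j ∧ ∀ k < j, walk f s k M < walk f s j M := by
  classical
  have hl := hs.pos
  have hstep : ∀ k, walk f s k M < walk f s (k + l) M := by
    intro k
    rw [hs.walk_add, RelIso.mul_apply, ← hs.lift_eq]
    exact (walk f s k).strictMono hM
  -- The first index of a maximum over the second period is a record, since the points visited in
  -- the first period are exceeded one period later.
  have hex : ∃ j, (l < j ∧ j ≤ 2 * l) ∧ ∀ k, l < k → k ≤ 2 * l → walk f s k M ≤ walk f s j M := by
    obtain ⟨j, hj, hmax⟩ := Finset.exists_max_image (Finset.Ioc l (2 * l))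
      (fun k => walk f s k M) ⟨l + 1, by simp; omega⟩
    simp only [Finset.mem_Ioc] at hj hmax
    exact ⟨j, hj, fun k h1 h2 => hmax k ⟨h1, h2⟩⟩
  obtain ⟨⟨h1, h2⟩, h3⟩ := Nat.find_spec hex
  refine ⟨Nat.find hex, h1, fun k hk => ?_⟩
  rcases Nat.lt_or_ge l k with h | h
  · refine lt_of_le_of_ne (h3 k h (by omega)) fun heq => Nat.find_min hex hk ⟨⟨h, by omega⟩, ?_⟩
    rw [heq]
    exact h3
  · rcases Nat.eq_zero_or_pos k with rfl | hk0
    · have e1 := hstep 0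
      have e2 := hstep (0 + l)
      exact (e1.trans e2).trans_le (h3 _ (by omega) (by omega))
    · exact (hstep k).trans_le (h3 _ (by omega) (by omega))

theorem shiftQ_pow_apply (n : ℕ) (x : ℚ) : (shiftQ ^ n) x = x + n := by
  have := shiftQ_zpow_apply n x
  rwa [zpow_natCast, Int.cast_natCast] at this

theorem CyclicReading.chain_mul {α : Type*} {c : FreeGroup α} {l : ℕ} {s : ℤ → α × Bool}
    (hs : CyclicReading c l s) {τ : α → ℚ ≃o ℚ} {y : ℤ → ℚ} (hτ : FreeGroup.lift τ c = shiftQ)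
    (hy : ∀ k, letter τ (s k) (y k) = y (k + 1)) (n : ℕ) : y ((n * l : ℕ) : ℤ) = y 0 + n := by
  rw [← walk_apply_of_chain hy, hs.walk_mul, hτ, shiftQ_pow_apply]

/-- An action in which `c` moves `M` up can be modified above `M` so that the orbit of `M` under `c`
becomes unbounded, and the orbit under the letters is eventually increasing. -/
theorem CyclicReading.exists_cofinal {α : Type*} {c : FreeGroup α} {l : ℕ}
    {s : ℤ → α × Bool} (hs : CyclicReading c l s) (f : α → ℚ ≃o ℚ) (M : ℚ)
    (hM : M < FreeGroup.lift f c M) :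
    ∃ f' : α → ℚ ≃o ℚ, AgreeBelow M f f' ∧
      (∀ x ≤ M, FreeGroup.lift f' c x = FreeGroup.lift f c x) ∧
      (∃ j, ∀ k, j ≤ k → ∀ i < k, walk f' s i M < walk f' s k M) ∧
      ∀ x, ∃ n : ℕ, x < (FreeGroup.lift f' c ^ n) M := by
  obtain ⟨j, hlj, hrec⟩ := hs.exists_record f M hM
  obtain ⟨τ, y, hτ, hymono, hy⟩ := hs.exists_translation
  -- The model is the action in which `c` is a translation, moved so that the orbits match at `j`.
  set d := walk f s j M - y j with hd
  let κ : ℚ ≃o ℚ := OrderIso.addRight d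
  have hκ : ∀ x, κ x = x + d := fun x => rfl
  obtain ⟨f', F1, F2, F3, F4, -⟩ := hs.exists_modification f (fun a => κ * τ a * κ⁻¹) M hlj hrec
    (fun k => κ (y k)) (by rw [hκ]; simp [hd])
    (fun k _ => by
      rw [letter_conj, RelIso.mul_apply, RelIso.mul_apply, RelIso.inv_apply_self, hy]; simp)
    (q := κ (y (j + 1))) (κ.strictMono (hymono (by omega)))
    (fun k hk => κ.monotone (hymono.monotone (by omega)))
  refine ⟨f', F1, F2, ⟨j, fun k hk i hik => ?_⟩, fun x => ?_⟩
  · rw [F4 k hk]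
    rcases le_or_gt j i with h | h
    · rw [F4 i h]
      exact κ.strictMono (hymono (by omega))
    · rw [F3 i h.le]
      refine (hrec i h).trans_le ?_
      rw [← F3 j le_rfl, F4 j le_rfl]
      exact κ.monotone (hymono.monotone (by omega))
  · obtain ⟨n, hn⟩ := exists_nat_gt (x - d - y 0)
    refine ⟨n + j, ?_⟩
    rw [← hs.walk_mul, F4 _ (by nlinarith [hs.pos]), hs.chain_mul hτ hy, hκ]
    push_cast
    have : (0 : ℚ) ≤ j := by positivity
    linarith

/-! ### Actions on the fibers of a lexicographic product -/

/-- The translation by `d` in the first factor and `u` in the second one, as an automorphism of the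
lexicographic product `ℤ ×ₗ ℚ`. -/
noncomputable def fiberMap (d : Multiplicative ℤ) (u : ℚ ≃o ℚ) : (ℤ ×ₗ ℚ) ≃o (ℤ ×ₗ ℚ) :=
  Prod.Lex.prodLexCongr (OrderIso.addRight d.toAdd) u

theorem fiberMap_apply (d : Multiplicative ℤ) (u : ℚ ≃o ℚ) (k : ℤ) (r : ℚ) :
    fiberMap d u (toLex (k, r)) = toLex (k + d.toAdd, u r) := rfl

/-- The action of a free group on `ℚ ≅ ℤ ×ₗ ℚ` which translates the fibers `{k} ×ₗ ℚ` by means of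
a homomorphism `φ` to `ℤ` and acts by `τ` along the fibers. -/
noncomputable def fiberAction {α : Type*} (θ : (ℤ ×ₗ ℚ) ≃o ℚ) (φ : α → Multiplicative ℤ)
    (τ : α → ℚ ≃o ℚ) (a : α) : ℚ ≃o ℚ :=
  (θ.symm.trans (fiberMap (φ a) (τ a))).trans θ

theorem fiberAction_apply {α : Type*} (θ : (ℤ ×ₗ ℚ) ≃o ℚ) (φ : α → Multiplicative ℤ)
    (τ : α → ℚ ≃o ℚ) (a : α) (k : ℤ) (r : ℚ) :
    fiberAction θ φ τ a (θ (toLex (k, r))) = θ (toLex (k + (φ a).toAdd, τ a r)) := by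
  simp [fiberAction, fiberMap_apply]

theorem letter_fiberAction_apply {α : Type*} (θ : (ℤ ×ₗ ℚ) ≃o ℚ) (φ : α → Multiplicative ℤ)
    (τ : α → ℚ ≃o ℚ) (z : α × Bool) (k : ℤ) (r : ℚ) :
    letter (fiberAction θ φ τ) z (θ (toLex (k, r))) =
      θ (toLex (k + (letter φ z).toAdd, letter τ z r)) := by
  obtain ⟨a, b⟩ := z
  cases b
  · rw [letter_apply_eq_iff, cond_false, fiberAction_apply]
    simp [letter]
  · exact fiberAction_apply θ φ τ a k r

theorem walk_fiberAction_apply {α : Type*} (θ : (ℤ ×ₗ ℚ) ≃o ℚ) (φ : α → Multiplicative ℤ)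
    (τ : α → ℚ ≃o ℚ) (s : ℤ → α × Bool) (n : ℕ) (k : ℤ) (r : ℚ) :
    walk (fiberAction θ φ τ) s n (θ (toLex (k, r))) =
      θ (toLex (k + (walk φ s n).toAdd, walk τ s n r)) := by
  induction n with
  | zero => simp [walk]
  | succ n ih =>
    rw [walk, RelIso.mul_apply, ih, letter_fiberAction_apply, walk, walk, RelIso.mul_apply,
      toAdd_mul]
    congr 3
    ring

theorem walk_conj {α H : Type*} [Group H] (f : α → H) (u : H) (s : ℤ → α × Bool) (n : ℕ) :
    walk (fun a => u * f a * u⁻¹) s n = u * walk f s n * u⁻¹ := by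
  have := map_walk (MulAut.conj u).toMonoidHom f s n
  simp only [MulEquiv.toMonoidHom_eq_coe, MonoidHom.coe_coe, MulAut.conj_apply] at this
  rw [this]
  rfl

/-- Along a periodic word with trivial image under `φ`, the height is minimal at arbitrarily late
positions. -/
theorem CyclicReading.exists_min_height {α : Type*} {c : FreeGroup α} {l : ℕ}
    {s : ℤ → α × Bool} (hs : CyclicReading c l s) (φ : α → Multiplicative ℤ)
    (hφ : FreeGroup.lift φ c = 1) (N : ℕ) :
    ∃ j, N ≤ j ∧ ∀ k, (walk φ s j).toAdd ≤ (walk φ s k).toAdd := by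
  have hmod : ∀ n k, walk φ s (k + n * l) = walk φ s k := by
    intro n
    induction n with
    | zero => simp
    | succ n ih =>
      intro k
      rw [Nat.succ_mul, ← add_assoc, hs.walk_add, ih, ← hs.lift_eq, hφ, mul_one]
  obtain ⟨i, hi, hmin⟩ := Finset.exists_min_image (Finset.range l)
    (fun k => (walk φ s k).toAdd) ⟨0, by simpa using hs.pos⟩
  refine ⟨i + N * l, ?_, fun k => ?_⟩
  · nlinarith [hs.pos]
  · rw [hmod, ← Nat.mod_add_div' k l, hmod]
    exact hmin _ (by simpa using Nat.mod_lt k hs.pos)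

/-- An action in which `c` moves `M` up can be modified above `M`, when `φ c = 1`, so that near `+∞`
it becomes the action on the fibers of `ℤ ×ₗ ℚ` with translation of the fibers by `φ`: the orbit of
`M` under `c` converges to the upper end of the fiber `{0} ×ₗ ℚ`, and `c` acts on the higher fibers
by `(k, r) ↦ (k, r + 1)`. If `φ` is nontrivial, the orbit of `M` reaches the higher fibers. -/
theorem CyclicReading.exists_fibered {α : Type*} {c : FreeGroup α} {l : ℕ}
    {s : ℤ → α × Bool} (hs : CyclicReading c l s) (f : α → ℚ ≃o ℚ) (M : ℚ)
    (hM : M < FreeGroup.lift f c M) (φ : α → Multiplicative ℤ) (hφ : FreeGroup.lift φ c = 1) :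
    ∃ T₀ : ℚ, ∀ θ : (ℤ ×ₗ ℚ) ≃o ℚ, T₀ < θ (toLex (0, 0)) →
      ∃ f' : α → ℚ ≃o ℚ, AgreeBelow M f f' ∧
        (∀ x ≤ M, FreeGroup.lift f' c x = FreeGroup.lift f c x) ∧
        (∀ x, (∃ n : ℕ, x ≤ (FreeGroup.lift f' c ^ n) M) ↔ ∃ r, x ≤ θ (toLex (0, r))) ∧
        (∀ (k : ℤ) (r : ℚ), 0 < k →
          FreeGroup.lift f' c (θ (toLex (k, r))) = θ (toLex (k, r + 1))) ∧
        ∀ a, φ a ≠ 1 → ∃ (u : FreeGroup α) (n : ℕ), ∀ r,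
          θ (toLex (0, r)) < FreeGroup.lift f' u ((FreeGroup.lift f' c ^ n) M) := by
  -- First the orbit is made eventually increasing, so that all late positions are records; then the
  -- model is glued in at a position `j` of minimal height, so that it never returns below `T`.
  obtain ⟨f₁, A1, A2, ⟨j₀, hrec⟩, -⟩ := hs.exists_cofinal f M hM
  obtain ⟨j, hj, hmin⟩ := hs.exists_min_height φ hφ (j₀ + l + 1)
  set H : ℕ → ℤ := fun k => (walk φ s k).toAdd with hH
  set T := walk f₁ s j M with hT
  obtain ⟨τ, y, hτ, hymono, hy⟩ := hs.exists_translation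
  refine ⟨T, fun θ hθ => ?_⟩
  have hθlt : ∀ {k k' : ℤ} {r r' : ℚ}, (k < k' ∨ k ≤ k' ∧ r < r') →
      θ (toLex (k, r)) < θ (toLex (k', r')) := by
    intro k k' r r' h
    refine θ.strictMono ?_
    rw [Prod.Lex.toLex_lt_toLex]
    dsimp only
    rcases h with h | ⟨h, h'⟩
    · exact Or.inl h
    · rcases h.eq_or_lt with h | h
      · exact Or.inr ⟨h, h'⟩
      · exact Or.inl h
  have hH0 : H j ≤ 0 := by simpa [hH, walk] using hmin 0
  set R : ℚ := max 0 (y (j + 1)) + 1 with hR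
  have hR1 : y (j + 1) < R := lt_of_le_of_lt (le_max_right _ _) (lt_add_one _)
  have hR0 : 0 < R := lt_of_le_of_lt (le_max_left _ _) (lt_add_one _)
  have hyj : y j < y (j + 1) := hymono (by omega)
  -- `κ` moves the model so that its point at the position `j` becomes the record `T`.
  obtain ⟨κ, hκ1, hκ2⟩ := exists_glue (OrderIso.addRight (T - θ (toLex (H j, y j))))
    (OrderIso.refl ℚ) (α := θ (toLex (H j, y j))) (β := θ (toLex (0, R)))
    (hθlt (Or.inr ⟨hH0, hyj.trans hR1⟩)) (by
      simp only [OrderIso.addRight_apply, add_sub_cancel, OrderIso.refl_apply]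
      exact hθ.trans (hθlt (Or.inr ⟨le_rfl, hR0⟩)))
  have hκT : κ (θ (toLex (H j, y j))) = T := by rw [hκ1 _ le_rfl]; simp
  have hκid : ∀ {k : ℤ} {r : ℚ}, (0 < k ∨ 0 ≤ k ∧ R < r) →
      κ (θ (toLex (k, r))) = θ (toLex (k, r)) := fun h => hκ2 _ (hθlt h).le
  have hκid' : ∀ {k : ℤ} {r : ℚ}, (0 < k ∨ 0 ≤ k ∧ R < r) →
      κ⁻¹ (θ (toLex (k, r))) = θ (toLex (k, r)) := fun h => by
    rw [← hκid h, RelIso.inv_apply_self, hκid h]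
  set g : α → ℚ ≃o ℚ := fun a => κ * fiberAction θ φ τ a * κ⁻¹ with hg
  set q := κ (θ (toLex (H j, y (j + 1)))) with hq
  have hgl : ∀ z k r, letter g z (κ (θ (toLex (k, r)))) =
      κ (θ (toLex (k + (letter φ z).toAdd, letter τ z r))) := fun z k r => by
    rw [hg, letter_conj, RelIso.mul_apply, RelIso.mul_apply, RelIso.inv_apply_self,
      letter_fiberAction_apply]
  have hgw : ∀ n k r, walk g s n (κ (θ (toLex (k, r)))) =
      κ (θ (toLex (k + H n, walk τ s n r))) := fun n k r => by
    rw [hg, walk_conj, RelIso.mul_apply, RelIso.mul_apply, RelIso.inv_apply_self,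
      walk_fiberAction_apply]
  obtain ⟨f', F1, F2, -, F4, F5⟩ := hs.exists_modification f₁ g M (j := j) (by omega)
    (hrec j (by omega)) (fun k => κ (θ (toLex (H k, y k)))) hκT
    (fun k _ => by
      rw [hgl, hy]
      simp only [hH, walk, toAdd_mul]
      push_cast
      rw [add_comm])
    (q := q) (κ.strictMono (hθlt (Or.inr ⟨le_rfl, hyj⟩)))
    (fun k hk => κ.monotone (by
      rcases (show j + 1 ≤ k from hk).eq_or_lt with h | h
      · refine θ.monotone ?_
        rw [Prod.Lex.toLex_le_toLex]
        rcases (hmin k).eq_or_lt with h' | h'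
        · exact Or.inr ⟨h', by rw [← h]; push_cast; exact le_rfl⟩
        · exact Or.inl h'
      · exact (hθlt (Or.inr ⟨hmin k, hymono (by omega)⟩)).le))
  have hHl : ∀ n, H (n * l) = 0 := fun n => by simp [hH, hs.walk_mul, hφ]
  have horb : ∀ n : ℕ, j ≤ n * l → R < y 0 + n →
      (FreeGroup.lift f' c ^ n) M = θ (toLex (0, y 0 + n)) := fun n h1 h2 => by
    rw [← hs.walk_mul, F4 _ h1, hHl, hs.chain_mul hτ hy, hκid (Or.inr ⟨le_rfl, h2⟩)]
  have hbig : ∀ r : ℚ, ∃ n : ℕ, j ≤ n * l ∧ R < y 0 + n ∧ r < y 0 + n := fun r => by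
    obtain ⟨n, hn⟩ := exists_nat_gt (max R r - y 0)
    have h1 := le_max_left R r
    have h2 := le_max_right R r
    have : (0 : ℚ) ≤ j := by positivity
    exact ⟨n + j, by nlinarith [hs.pos], by push_cast; linarith, by push_cast; linarith⟩
  have hqκ : ∀ {k : ℤ} {r : ℚ}, (H j < k ∨ H j ≤ k ∧ y (j + 1) < r) →
      q ≤ κ (θ (toLex (k, r))) := fun h => κ.monotone (hθlt h).le
  refine ⟨f', A1.trans F1, fun x hx => by rw [F2 x hx, A2 x hx], fun x => ⟨?_, ?_⟩,
    fun k r hk => ?_, fun a ha => ?_⟩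
  · rintro ⟨n, hn⟩
    obtain ⟨m, h1, h2, -⟩ := hbig 0
    have hfix : ∀ i : ℕ, (FreeGroup.lift f' c ^ i) M ≤ (FreeGroup.lift f' c ^ (i + 1)) M := by
      intro i
      rw [pow_succ, RelIso.mul_apply]
      refine (FreeGroup.lift f' c ^ i).monotone ?_
      rw [F2 M le_rfl, A2 M le_rfl]
      exact hM.le
    have hmono : Monotone fun i : ℕ => (FreeGroup.lift f' c ^ i) M := monotone_nat_of_le_succ hfix
    have hmn : ((m : ℕ) : ℚ) ≤ ((max m n : ℕ) : ℚ) := by exact_mod_cast le_max_left m n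
    refine ⟨y 0 + (max m n : ℕ), (hn.trans (hmono (le_max_right m n))).trans_eq (horb _ ?_ ?_)⟩
    · exact h1.trans (Nat.mul_le_mul_right _ (le_max_left m n))
    · linarith
  · rintro ⟨r, hr⟩
    obtain ⟨n, h1, h2, h3⟩ := hbig r
    exact ⟨n, by rw [horb n h1 h2]; exact hr.trans (hθlt (Or.inr ⟨le_rfl, h3⟩)).le⟩
  -- On the fibers of positive height all points visited under `c` lie above `q`, where `f'` is the
  -- model.
  · have hw : ∀ n, walk f' s n (θ (toLex (k, r))) = walk g s n (θ (toLex (k, r))) := by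
      intro n
      have hge : ∀ i, q ≤ walk g s i (θ (toLex (k, r))) := fun i => by
        have := hmin i
        rw [← hκid (Or.inl hk), hgw]
        exact hqκ (Or.inl (by simp only [hH] at this ⊢; omega))
      induction n with
      | zero => simp [walk]
      | succ n ih =>
        have := hge (n + 1)
        rw [walk, RelIso.mul_apply] at this
        rw [walk, walk, RelIso.mul_apply, RelIso.mul_apply, ih]
        exact letter_eq_of_upper F5 _ (hge n) this
    have hHl1 := hHl 1
    rw [one_mul] at hHl1
    rw [hs.lift_eq, hw, ← hκid (Or.inl hk), hgw, hHl1, add_zero, ← hs.lift_eq, hτ, shiftQ_apply,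
      hκid (Or.inl hk)]
  -- A signed letter of positive height takes the orbit of `M` to a higher fiber.
  · obtain ⟨b, hb⟩ : ∃ b : Bool, 0 < (letter φ (a, b)).toAdd := by
      have : (φ a).toAdd ≠ 0 := by simpa using ha
      rcases lt_or_gt_of_ne this with h | h
      · exact ⟨false, by simpa [letter] using h⟩
      · exact ⟨true, by simpa [letter] using h⟩
    obtain ⟨n, h1, h2, -⟩ := hbig 0
    refine ⟨letter FreeGroup.of (a, b), n, fun r => ?_⟩
    have hlift : FreeGroup.lift f' (letter FreeGroup.of (a, b)) = letter f' (a, b) := by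
      rw [map_letter]
      congr 1
    have e1 : letter g (a, b) (θ (toLex (0, y 0 + n))) =
        θ (toLex (0 + (letter φ (a, b)).toAdd, letter τ (a, b) (y 0 + n))) := by
      rw [← hκid (Or.inr ⟨le_rfl, h2⟩), hgl, hκid (Or.inl (by omega))]
    rw [horb n h1 h2, hlift, letter_eq_of_upper F5 (a, b), e1]
    · exact hθlt (Or.inl (by omega))
    · rw [← hκid (Or.inr ⟨le_rfl, h2⟩)]
      exact hqκ (Or.inr ⟨hH0, hR1.trans h2⟩)
    · rw [e1, ← hκid (Or.inl (by omega))]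
      exact hqκ (Or.inl (by omega))

/-! ### Conjugating automorphisms that agree below a point -/

/-- Two automorphisms of `ℚ` which agree up to a point `M` moved up by them, and also above the
limit of their orbits of `M`, are conjugate by an automorphism fixing `(-∞, M]`. -/
theorem exists_conj_of_eq_below (f g : ℚ ≃o ℚ) (M : ℚ) (hfg : ∀ x ≤ M, f x = g x) (hM : M < f M)
    (hΛ : ∀ x, (∃ n : ℕ, x ≤ (f ^ n) M) ↔ ∃ n : ℕ, x ≤ (g ^ n) M)
    (hoff : ∀ x, (∀ n : ℕ, (f ^ n) M < x) → f x = g x) :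
    ∃ h : ℚ ≃o ℚ, (∀ x ≤ M, h x = x) ∧ h * f * h⁻¹ = g := by
  classical
  have hMg : M < g M := by rwa [← hfg M le_rfl]
  have hpow : ∀ (u v : ℚ ≃o ℚ), (∀ x ≤ M, u x = v x) → M < u M → ∀ x ≤ M, ∀ n : ℕ,
      (u⁻¹ ^ n) x ≤ M ∧ (v ^ n) ((u⁻¹ ^ n) x) = x := by
    intro u v huv hu x hx n
    induction n with
    | zero => simpa using hx
    | succ n ih =>
      have e : u ((u⁻¹ ^ (n + 1)) x) = (u⁻¹ ^ n) x := by
        rw [pow_succ', RelIso.mul_apply, RelIso.apply_inv_self]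
      have h1 : (u⁻¹ ^ (n + 1)) x ≤ M := by
        rw [← u.le_iff_le, e]
        exact ih.1.trans hu.le
      refine ⟨h1, ?_⟩
      rw [pow_succ, RelIso.mul_apply, ← huv _ h1, e, ih.2]
  have hcancel : ∀ (u : ℚ ≃o ℚ) (n : ℕ) (x : ℚ), (u ^ n) ((u⁻¹ ^ n) x) = x := by
    intro u n x
    rw [← RelIso.mul_apply, inv_pow, mul_inv_cancel, RelIso.one_apply]
  have hcancel' : ∀ (u : ℚ ≃o ℚ) (n : ℕ) (x : ℚ), (u⁻¹ ^ n) ((u ^ n) x) = x := by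
    intro u n x
    rw [← RelIso.mul_apply, inv_pow, inv_mul_cancel, RelIso.one_apply]
  have hle : ∀ (u : ℚ ≃o ℚ) (n : ℕ) (x : ℚ), x ≤ (u ^ n) M ↔ (u⁻¹ ^ n) x ≤ M := by
    intro u n x
    rw [← (u ^ n).le_iff_le (x := (u⁻¹ ^ n) x), hcancel]
  -- Below the limit of the orbits, the conjugating automorphism is the eventual value of `gⁿ f⁻ⁿ`;
  -- elsewhere it is the identity.
  let F : ℚ → ℚ := fun x =>
    if hx : ∃ n : ℕ, x ≤ (f ^ n) M then (g ^ hx.choose) ((f⁻¹ ^ hx.choose) x) else x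
  have hstab : ∀ x (n m : ℕ), x ≤ (f ^ n) M →
      (g ^ (n + m)) ((f⁻¹ ^ (n + m)) x) = (g ^ n) ((f⁻¹ ^ n) x) := by
    intro x n m hx
    rw [add_comm, pow_add f⁻¹, add_comm, pow_add g, RelIso.mul_apply, RelIso.mul_apply,
      (hpow f g hfg hM _ ((hle f n x).1 hx) m).2]
  have F1 : ∀ x (n : ℕ), x ≤ (f ^ n) M → F x = (g ^ n) ((f⁻¹ ^ n) x) := by
    intro x n hx
    have hex : ∃ n : ℕ, x ≤ (f ^ n) M := ⟨n, hx⟩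
    have e1 := hstab x n hex.choose hx
    have e2 := hstab x hex.choose n hex.choose_spec
    simp only [F]
    rw [dif_pos hex, ← e2, add_comm, e1]
  have F2 : ∀ x, (¬ ∃ n : ℕ, x ≤ (f ^ n) M) → F x = x := fun x hx => dif_neg hx
  have hup : ∀ i m : ℕ, (f ^ i) M ≤ (f ^ (i + m)) M := by
    intro i m
    induction m with
    | zero => exact le_rfl
    | succ m ih =>
      refine ih.trans ?_
      rw [← add_assoc, pow_succ, RelIso.mul_apply]
      exact (f ^ (i + m)).monotone hM.le
  have hmono : StrictMono F := by
    intro x y hxy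
    by_cases hy : ∃ n : ℕ, y ≤ (f ^ n) M
    · obtain ⟨n, hn⟩ := hy
      rw [F1 y n hn, F1 x n (hxy.le.trans hn)]
      exact (g ^ n).strictMono ((f⁻¹ ^ n).strictMono hxy)
    · rw [F2 y hy]
      by_cases hx : ∃ n : ℕ, x ≤ (f ^ n) M
      · obtain ⟨n, hn⟩ := hx
        rw [F1 x n hn]
        by_contra hcon
        refine hy ((hΛ y).2 ⟨n, (not_lt.1 hcon).trans ?_⟩)
        exact (g ^ n).monotone ((hle f n x).1 hn)
      · rwa [F2 x hx]
  have hsurj : Function.Surjective F := by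
    intro y
    by_cases hy : ∃ n : ℕ, y ≤ (f ^ n) M
    · obtain ⟨n, hn⟩ := (hΛ y).1 hy
      refine ⟨(f ^ n) ((g⁻¹ ^ n) y), ?_⟩
      rw [F1 _ n ((f ^ n).monotone ((hle g n y).1 hn)), hcancel', hcancel]
    · exact ⟨y, F2 y hy⟩
  set h : ℚ ≃o ℚ := hmono.orderIsoOfSurjective F hsurj with hh
  have hF : ∀ x, h x = F x := fun x => rfl
  refine ⟨h, fun x hx => by rw [hF, F1 x 0 (by simpa using hx)]; simp, ?_⟩
  rw [mul_inv_eq_iff_eq_mul]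
  ext x
  rw [RelIso.mul_apply, RelIso.mul_apply, hF, hF]
  by_cases hx : ∃ n : ℕ, x ≤ (f ^ n) M
  · obtain ⟨n, hn⟩ := hx
    rw [F1 x n hn, F1 (f x) (n + 1) (by rw [pow_succ', RelIso.mul_apply]; exact f.monotone hn),
      pow_succ f⁻¹, RelIso.mul_apply, RelIso.inv_apply_self, pow_succ' g, RelIso.mul_apply]
  · have hfx : ¬ ∃ n : ℕ, f x ≤ (f ^ n) M := by
      rintro ⟨n, hn⟩
      refine hx ⟨n, ?_⟩
      rw [← f.le_iff_le]
      refine (hn.trans (hup n 1)).trans_eq ?_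
      rw [pow_succ', RelIso.mul_apply]
    rw [F2 x hx, F2 _ hfx]
    exact hoff x fun n => not_le.1 fun h => hx ⟨n, h⟩

/-! ### Left orders and actions on the rationals -/

namespace LeftOrder

variable {G : Type*} [Group G] (P : LeftOrder G)

theorem lt_iff_not_le {a b : G} : P.lt a b ↔ ¬ P.le b a := by
  constructor
  · rintro ⟨h, hne⟩ h'
    exact hne (P.le_antisymm _ _ h h')
  · intro h
    refine ⟨(P.le_total a b).resolve_right h, ?_⟩
    rintro rfl
    exact h (P.le_refl a)

theorem mul_lt_mul_left (g : G) {a b : G} (h : P.lt a b) : P.lt (g * a) (g * b) :=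
  ⟨P.mul_le_mul_left g a b h.1, fun h' => h.2 (mul_left_cancel h')⟩

theorem lt_trichotomy (a b : G) : P.lt a b ∨ a = b ∨ P.lt b a := by
  by_cases h : a = b
  · exact Or.inr (Or.inl h)
  · rcases P.le_total a b with h' | h'
    · exact Or.inl ⟨h', h⟩
    · exact Or.inr (Or.inr ⟨h', Ne.symm h⟩)

theorem lt_trans {a b c : G} (h : P.lt a b) (h' : P.lt b c) : P.lt a c := by
  refine ⟨P.le_trans _ _ _ h.1 h'.1, ?_⟩
  rintro rfl
  exact h.2 (P.le_antisymm _ _ h.1 h'.1)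

theorem not_lt_of_lt {a b : G} (h : P.lt a b) : ¬ P.lt b a := fun h' => (P.lt_trans h h').2 rfl

theorem exists_one_lt {w : G} (hw : w ≠ 1) : ∃ g, P.lt 1 g := by
  rcases P.lt_trichotomy 1 w with h | h | h
  · exact ⟨w, h⟩
  · exact absurd h.symm hw
  · refine ⟨w⁻¹, ?_⟩
    simpa using P.mul_lt_mul_left w⁻¹ h

/-- A left order as an order instance on the group. -/
@[reducible]
noncomputable def toLinearOrder : LinearOrder G where
  le := P.le
  le_refl := P.le_refl
  le_trans := P.le_trans
  le_antisymm := P.le_antisymm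
  le_total := P.le_total
  toDecidableLE := Classical.decRel _

theorem lt_iff_toLinearOrder {a b : G} : P.lt a b ↔ P.toLinearOrder.lt a b :=
  P.lt_iff_not_le.trans (@not_le G P.toLinearOrder b a)

/-- The left order in which `a` is below `b` if the action `ρ` moves `x₀` further by `b` than by
`a`, ties being broken by the left order `P`. -/
def ofAction (ρ : G →* (ℚ ≃o ℚ)) (x₀ : ℚ) : LeftOrder G where
  le a b := ρ a x₀ < ρ b x₀ ∨ ρ a x₀ = ρ b x₀ ∧ P.le a b
  le_refl a := Or.inr ⟨rfl, P.le_refl a⟩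
  le_trans a b c := by
    rintro (h | ⟨h, h'⟩) (k | ⟨k, k'⟩)
    · exact Or.inl (h.trans k)
    · exact Or.inl (k ▸ h)
    · exact Or.inl (h ▸ k)
    · exact Or.inr ⟨h.trans k, P.le_trans _ _ _ h' k'⟩
  le_antisymm a b := by
    rintro (h | ⟨h, h'⟩) (k | ⟨k, k'⟩)
    · exact absurd k h.not_gt
    · exact absurd k h.ne'
    · exact absurd h k.ne'
    · exact P.le_antisymm _ _ h' k'
  le_total a b := by
    rcases _root_.lt_trichotomy (ρ a x₀) (ρ b x₀) with h | h | h
    · exact Or.inl (Or.inl h)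
    · exact (P.le_total a b).imp (fun h' => Or.inr ⟨h, h'⟩) (fun h' => Or.inr ⟨h.symm, h'⟩)
    · exact Or.inr (Or.inl h)
  mul_le_mul_left g a b := by
    rw [map_mul, map_mul, RelIso.mul_apply, RelIso.mul_apply]
    rintro (h | ⟨h, h'⟩)
    · exact Or.inl ((ρ g).strictMono h)
    · exact Or.inr ⟨by rw [h], P.mul_le_mul_left g a b h'⟩

theorem ofAction_lt (ρ : G →* (ℚ ≃o ℚ)) {x₀ : ℚ} {a b : G} (h : ρ a x₀ < ρ b x₀) :
    (P.ofAction ρ x₀).lt a b :=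
  ⟨Or.inl h, by rintro rfl; exact h.ne rfl⟩

end LeftOrder

/-- A left order of a nontrivial countable group `G` is induced by an action of `G` on `ℚ`, namely
the one on `G ×ₗ ℚ ≅ ℚ`. All its point stabilizers are trivial. -/
theorem LeftOrder.exists_action {G : Type*} [Group G] [Countable G] (P : LeftOrder G) {w : G}
    (hw : w ≠ 1) :
    ∃ (ρ : G →* (ℚ ≃o ℚ)) (x₀ : ℚ), (∀ a b, P.lt a b → ρ a x₀ < ρ b x₀) ∧
      (∀ g x, ρ g x = x → g = 1) ∧ (∀ x, ∃ g, x < ρ g x₀) ∧ ∀ x, ∃ g, ρ g x₀ < x := by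
  let _ := P.toLinearOrder
  have hlt : ∀ {a b : G}, P.lt a b ↔ a < b := P.lt_iff_toLinearOrder
  have hmul : ∀ (g : G) {a b : G}, a < b → g * a < g * b := fun g a b h =>
    hlt.1 (P.mul_lt_mul_left g (hlt.2 h))
  have : Countable (G ×ₗ ℚ) := inferInstanceAs (Countable (G × ℚ))
  obtain ⟨e⟩ := Order.iso_of_countable_dense (G ×ₗ ℚ) ℚ
  let L : G → (G ≃o G) := fun g =>
    { toEquiv := Equiv.mulLeft g
      map_rel_iff' := by
        intro a b
        refine ⟨fun h => ?_, fun h => P.mul_le_mul_left g a b h⟩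
        have := P.mul_le_mul_left g⁻¹ _ _ h
        rwa [Equiv.coe_mulLeft, inv_mul_cancel_left, inv_mul_cancel_left] at this }
  let A : G → (ℚ ≃o ℚ) := fun g =>
    (e.symm.trans (Prod.Lex.prodLexCongr (L g) (OrderIso.refl ℚ))).trans e
  have hA : ∀ g h r, A g (e (toLex (h, r))) = e (toLex (g * h, r)) := by
    intro g h r
    simp only [A, OrderIso.trans_apply, OrderIso.symm_apply_apply]
    rfl
  have hform : ∀ x, ∃ h r, x = e (toLex (h, r)) := fun x =>
    ⟨(ofLex (e.symm x)).1, (ofLex (e.symm x)).2, by simp⟩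
  let ρ : G →* (ℚ ≃o ℚ) := MonoidHom.mk' A (by
    intro g g'
    ext x
    obtain ⟨h, r, rfl⟩ := hform x
    rw [RelIso.mul_apply, hA, hA, hA, mul_assoc])
  have hρ : ∀ g h r, ρ g (e (toLex (h, r))) = e (toLex (g * h, r)) := hA
  obtain ⟨p, hp⟩ := P.exists_one_lt hw
  rw [hlt] at hp
  refine ⟨ρ, e (toLex (1, 0)), fun a b hab => ?_, fun g x hx => ?_, fun x => ?_, fun x => ?_⟩
  · rw [hρ, hρ, mul_one, mul_one]
    exact e.strictMono (Prod.Lex.toLex_lt_toLex.2 (Or.inl (hlt.1 hab)))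
  · obtain ⟨h, r, rfl⟩ := hform x
    rw [hρ, e.injective.eq_iff, toLex.injective.eq_iff, Prod.mk.injEq] at hx
    simpa using hx.1
  · obtain ⟨h, r, rfl⟩ := hform x
    refine ⟨h * p, ?_⟩
    rw [hρ, mul_one]
    exact e.strictMono (Prod.Lex.toLex_lt_toLex.2 (Or.inl (by simpa using hmul h hp)))
  · obtain ⟨h, r, rfl⟩ := hform x
    refine ⟨h * p⁻¹, ?_⟩
    rw [hρ, mul_one]
    exact e.strictMono (Prod.Lex.toLex_lt_toLex.2 (Or.inl (by simpa using hmul (h * p⁻¹) hp)))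

/-- A countable group in which every nontrivial element acts nontrivially in some action on `ℚ` is
left orderable: compare group elements by the first point, in an enumeration of all points of the
chosen actions, on which they differ. -/
theorem LeftOrder.nonempty_of_residual {G : Type*} [Group G] [Countable G]
    (h : ∀ g : G, g ≠ 1 → ∃ (ρ : G →* (ℚ ≃o ℚ)) (x : ℚ), ρ g x ≠ x) :
    Nonempty (LeftOrder G) := by
  choose! ρ x hx using h
  obtain ⟨e, he⟩ := exists_surjective_nat G
  let v : G → Lex (ℕ → ℚ) := fun g => toLex fun n => ρ (e n) g (x (e n))
  have hv : Function.Injective v := by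
    intro a b hab
    by_contra hne
    have hne' : a⁻¹ * b ≠ 1 := fun h => hne (inv_mul_eq_one.1 h)
    obtain ⟨n, hn⟩ := he (a⁻¹ * b)
    have := congrFun (toLex.injective hab) n
    simp only [hn] at this
    refine hx _ hne' ?_
    rw [map_mul, RelIso.mul_apply, map_inv, ← this, RelIso.inv_apply_self]
  have hmul : ∀ g a b, v a < v b → v (g * a) < v (g * b) := by
    rintro g a b ⟨i, hi1, hi2⟩
    refine ⟨i, fun j hj => ?_, ?_⟩
    · have := hi1 j hj
      simp only [v, map_mul, RelIso.mul_apply] at this ⊢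
      exact congrArg _ this
    · simp only [v, map_mul, RelIso.mul_apply] at hi2 ⊢
      exact (ρ (e i) g).strictMono hi2
  exact ⟨{
    le := fun a b => v a ≤ v b
    le_refl := fun a => le_rfl
    le_trans := fun a b c => _root_.le_trans
    le_antisymm := fun a b h h' => hv (_root_.le_antisymm h h')
    le_total := fun a b => _root_.le_total _ _
    mul_le_mul_left := fun g a b h => by
      rcases h.eq_or_lt with h | h
      · rw [hv h]
      · exact (hmul g a b h).le }⟩

/-! ### Perturbing the left orders of an amalgam of free groups -/

theorem MonoidHom.range_comp_conj {H G : Type*} [Group H] [Group G] (ι : H →* G) (u : H) :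
    (ι.comp (MulAut.conj u).toMonoidHom).range = ι.range := by
  rw [MonoidHom.range_comp, MonoidHom.range_eq_top.2 (MulAut.conj u).surjective,
    ← MonoidHom.range_eq_map]

/-- `G` is, by means of `ιA` and `ιB`, the amalgam of two free groups in which `w₁` and `w₂` are
identified: it is generated by the images of `ιA` and `ιB`, and homomorphisms to a group which agree
on `w₁` and `w₂` extend to `G`. The universal property is only required for groups in `Type`, where
the automorphism group of `ℚ` lives. -/
structure IsAmalgam {α β G : Type*} [Group G] (ιA : FreeGroup α →* G) (ιB : FreeGroup β →* G)
    (w₁ : FreeGroup α) (w₂ : FreeGroup β) : Prop where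
  comm : ιA w₁ = ιB w₂
  gen : ιA.range ⊔ ιB.range = ⊤
  lift : ∀ {H : Type} [Group H] (f : FreeGroup α →* H) (g : FreeGroup β →* H), f w₁ = g w₂ →
    ∃ ρ : G →* H, (∀ u, ρ (ιA u) = f u) ∧ ∀ u, ρ (ιB u) = g u

namespace IsAmalgam

variable {α β G : Type*} [Group G] {ιA : FreeGroup α →* G} {ιB : FreeGroup β →* G}
  {w₁ : FreeGroup α} {w₂ : FreeGroup β}

theorem inv (h : IsAmalgam ιA ιB w₁ w₂) : IsAmalgam ιA ιB w₁⁻¹ w₂⁻¹ where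
  comm := by rw [map_inv, map_inv, h.comm]
  gen := h.gen
  lift f g hfg := h.lift f g (by rwa [map_inv, map_inv, inv_inj] at hfg)

/-- Replacing the amalgamated elements by conjugates in the two free groups. -/
theorem conj {u c₁ : FreeGroup α} {v c₂ : FreeGroup β}
    (h : IsAmalgam ιA ιB (u * c₁ * u⁻¹) (v * c₂ * v⁻¹)) :
    IsAmalgam (ιA.comp (MulAut.conj u).toMonoidHom) (ιB.comp (MulAut.conj v).toMonoidHom)
      c₁ c₂ where
  comm := h.comm
  gen := by
    rw [MonoidHom.range_comp_conj, MonoidHom.range_comp_conj, h.gen]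
  lift f g hfg := by
    obtain ⟨ρ, h1, h2⟩ := h.lift (f.comp (MulAut.conj u⁻¹).toMonoidHom)
      (g.comp (MulAut.conj v⁻¹).toMonoidHom) (by simpa [mul_assoc] using hfg)
    refine ⟨ρ, fun x => ?_, fun x => ?_⟩
    · simpa [mul_assoc] using h1 (u * x * u⁻¹)
    · simpa [mul_assoc] using h2 (v * x * v⁻¹)

/-- To prove a property of all elements of an amalgam it suffices to prove it for the generators of
the two free groups and to show that it passes to products and inverses. -/
theorem induction (h : IsAmalgam ιA ιB w₁ w₂) {p : G → Prop} (hA : ∀ a, p (ιA (FreeGroup.of a)))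
    (hB : ∀ b, p (ιB (FreeGroup.of b))) (hone : p 1) (hmul : ∀ x y, p x → p y → p (x * y))
    (hinv : ∀ x, p x → p x⁻¹) (g : G) : p g := by
  let S : Subgroup G :=
    { carrier := {x | p x}
      mul_mem' := fun {x y} => hmul x y
      one_mem' := hone
      inv_mem' := fun {x} => hinv x }
  have hS : ιA.range ⊔ ιB.range ≤ S := by
    refine sup_le ?_ ?_
    · rintro _ ⟨u, rfl⟩
      induction u using FreeGroup.induction_on with
      | C1 => simp
      | of a => exact hA a
      | inv_of a ha => rw [map_inv]; exact S.inv_mem ha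
      | mul x y hx hy => rw [map_mul]; exact S.mul_mem hx hy
    · rintro _ ⟨u, rfl⟩
      induction u using FreeGroup.induction_on with
      | C1 => simp
      | of a => exact hB a
      | inv_of a ha => rw [map_inv]; exact S.inv_mem ha
      | mul x y hx hy => rw [map_mul]; exact S.mul_mem hx hy
  rw [h.gen] at hS
  exact hS (Subgroup.mem_top g)

end IsAmalgam

/-- Two actions on `ℚ` of a group with homomorphisms from two free groups agree below `M`, in the
sense that their pullbacks to both free groups do. -/
def AgreeOn {α β G : Type*} [Group G] (ιA : FreeGroup α →* G) (ιB : FreeGroup β →* G) (M : ℚ)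
    (ρ ρ' : G →* (ℚ ≃o ℚ)) : Prop :=
  AgreeBelow M (fun a => ρ (ιA (FreeGroup.of a))) (fun a => ρ' (ιA (FreeGroup.of a))) ∧
    AgreeBelow M (fun b => ρ (ιB (FreeGroup.of b))) (fun b => ρ' (ιB (FreeGroup.of b)))

namespace IsAmalgam

variable {α β G : Type*} [Group G] {ιA : FreeGroup α →* G} {ιB : FreeGroup β →* G}
  {w₁ : FreeGroup α} {w₂ : FreeGroup β}

/-- The image of a point under a group element depends on the action only below some bound. -/
theorem exists_bound (h : IsAmalgam ιA ιB w₁ w₂) (ρ : G →* (ℚ ≃o ℚ)) (g : G) :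
    ∀ x, ∃ e, ∀ M, e ≤ M → ∀ ρ', AgreeOn ιA ιB M ρ ρ' → ρ' g x = ρ g x := by
  induction g using h.induction with
  | hA a =>
    intro x
    refine ⟨max x (ρ (ιA (FreeGroup.of a)) x), fun M hM ρ' hρ' => ?_⟩
    exact hρ'.1 a x ((le_max_left _ _).trans hM) (Or.inl ((le_max_right _ _).trans hM))
  | hB b =>
    intro x
    refine ⟨max x (ρ (ιB (FreeGroup.of b)) x), fun M hM ρ' hρ' => ?_⟩
    exact hρ'.2 b x ((le_max_left _ _).trans hM) (Or.inl ((le_max_right _ _).trans hM))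
  | hone => intro x; exact ⟨0, fun M _ ρ' _ => by simp⟩
  | hmul g g' hg hg' =>
    intro x
    obtain ⟨e', he'⟩ := hg' x
    obtain ⟨e, he⟩ := hg (ρ g' x)
    refine ⟨max e e', fun M hM ρ' hρ' => ?_⟩
    rw [map_mul, map_mul, RelIso.mul_apply, RelIso.mul_apply,
      he' M ((le_max_right _ _).trans hM) ρ' hρ', he M ((le_max_left _ _).trans hM) ρ' hρ']
  | hinv g hg =>
    intro x
    obtain ⟨e, he⟩ := hg (ρ g⁻¹ x)
    refine ⟨e, fun M hM ρ' hρ' => ?_⟩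
    have := he M hM ρ' hρ'
    rw [map_inv, RelIso.apply_inv_self] at this
    rw [map_inv, map_inv, ← this, RelIso.inv_apply_self, this]

/-- If an orbit exceeds `M` in some action, it also does in any action agreeing with it
below `M`. -/
theorem exists_lt_of_agreeOn (h : IsAmalgam ιA ιB w₁ w₂) {ρ ρ' : G →* (ℚ ≃o ℚ)} {M x₀ : ℚ}
    (hρ' : AgreeOn ιA ιB M ρ ρ') {g₀ : G} (hg₀ : M < ρ g₀ x₀) : ∃ g, M < ρ' g x₀ := by
  by_contra! hcon
  -- Otherwise the orbit of `x₀` is the same in both actions.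
  have key : ∀ g h', ρ g (ρ' h' x₀) = ρ' g (ρ' h' x₀) := by
    intro g
    induction g using h.induction with
    | hA a =>
      intro h'
      refine (hρ'.1 a _ (hcon h') (Or.inr ?_)).symm
      have := hcon (ιA (FreeGroup.of a) * h')
      rwa [map_mul, RelIso.mul_apply] at this
    | hB b =>
      intro h'
      refine (hρ'.2 b _ (hcon h') (Or.inr ?_)).symm
      have := hcon (ιB (FreeGroup.of b) * h')
      rwa [map_mul, RelIso.mul_apply] at this
    | hone => simp
    | hmul g g' hg hg' =>
      intro h'
      rw [map_mul, map_mul, RelIso.mul_apply, RelIso.mul_apply, hg' h']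
      have := hg (g' * h')
      rwa [map_mul, RelIso.mul_apply] at this
    | hinv g hg =>
      intro h'
      have := hg (g⁻¹ * h')
      rw [map_mul, RelIso.mul_apply, map_inv, RelIso.apply_inv_self] at this
      rw [map_inv, map_inv]
      conv_lhs => rw [← this]
      exact RelIso.inv_apply_self _ _
  have := key g₀ 1
  rw [map_one, RelIso.one_apply] at this
  rw [this] at hg₀
  exact hg₀.not_ge (hcon g₀)

/-- Modified actions of the two free groups fit together after a conjugation of the second one,
provided that the amalgamated elements act in the same way below `M` and above the limit of their
orbits of `M`. -/
theorem exists_modified (h : IsAmalgam ιA ιB w₁ w₂) (ρ : G →* (ℚ ≃o ℚ)) (M : ℚ)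
    (hM : M < ρ (ιA w₁) M) (f : α → ℚ ≃o ℚ) (g : β → ℚ ≃o ℚ)
    (hf : AgreeBelow M (fun a => ρ (ιA (FreeGroup.of a))) f)
    (hg : AgreeBelow M (fun b => ρ (ιB (FreeGroup.of b))) g)
    (hfw : ∀ x ≤ M, FreeGroup.lift f w₁ x = ρ (ιA w₁) x)
    (hgw : ∀ x ≤ M, FreeGroup.lift g w₂ x = ρ (ιA w₁) x)
    (hΛ : ∀ x, (∃ n : ℕ, x ≤ (FreeGroup.lift g w₂ ^ n) M) ↔
      ∃ n : ℕ, x ≤ (FreeGroup.lift f w₁ ^ n) M)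
    (hoff : ∀ x, (∀ n : ℕ, (FreeGroup.lift g w₂ ^ n) M < x) →
      FreeGroup.lift g w₂ x = FreeGroup.lift f w₁ x) :
    ∃ ρ' : G →* (ℚ ≃o ℚ), AgreeOn ιA ιB M ρ ρ' ∧ ∀ u, ρ' (ιA u) = FreeGroup.lift f u := by
  obtain ⟨η, hη, hconj⟩ := exists_conj_of_eq_below (FreeGroup.lift g w₂) (FreeGroup.lift f w₁) M
    (fun x hx => by rw [hfw x hx, hgw x hx]) (by rwa [hgw M le_rfl]) hΛ hoff
  obtain ⟨ρ', h1, h2⟩ := h.lift (FreeGroup.lift f)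
    ((MulAut.conj η).toMonoidHom.comp (FreeGroup.lift g)) hconj.symm
  have hη' : ∀ x ≤ M, η⁻¹ x = x := fun x hx => by
    conv_lhs => rw [← hη x hx]
    exact RelIso.inv_apply_self _ _
  refine ⟨ρ', ⟨fun a x hx hfx => ?_, fun b x hx hgx => ?_⟩, h1⟩
  · simp only [h1, FreeGroup.lift_apply_of] at hfx ⊢
    exact hf a x hx hfx
  · have e : ρ' (ιB (FreeGroup.of b)) x = η (g b x) := by
      rw [h2]
      simp only [MonoidHom.comp_apply, FreeGroup.lift_apply_of, MulEquiv.toMonoidHom_eq_coe,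
        MonoidHom.coe_coe, MulAut.conj_apply, RelIso.mul_apply]
      rw [hη' x hx]
    simp only [e] at hgx ⊢
    have hle : g b x ≤ M → η (g b x) = g b x := hη _
    have hgx' : ρ (ιB (FreeGroup.of b)) x ≤ M ∨ g b x ≤ M := by
      refine hgx.imp id fun h' => ?_
      have := hη' _ h'
      rw [RelIso.inv_apply_self] at this
      rwa [this]
    have e2 := hg b x hx hgx'
    rw [hle, e2]
    rcases hgx' with h' | h'
    · rw [e2]; exact h'
    · exact h'

end IsAmalgam

theorem RelIso.pow_apply_mono {u : ℚ ≃o ℚ} {x : ℚ} (hx : x ≤ u x) :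
    Monotone fun n : ℕ => (u ^ n) x :=
  monotone_nat_of_le_succ fun n => by
    rw [pow_succ, RelIso.mul_apply]
    exact (u ^ n).monotone hx

theorem exists_fiber_iso (T : ℚ) : ∃ θ : (ℤ ×ₗ ℚ) ≃o ℚ, T < θ (toLex (0, 0)) := by
  have : Countable (ℤ ×ₗ ℚ) := inferInstanceAs (Countable (ℤ × ℚ))
  obtain ⟨e⟩ := Order.iso_of_countable_dense (ℤ ×ₗ ℚ) ℚ
  exact ⟨e.trans (OrderIso.addRight (T + 1 - e (toLex (0, 0)))), by simp⟩

namespace IsAmalgam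

variable {α β G : Type*} [Group G] {ιA : FreeGroup α →* G} {ιB : FreeGroup β →* G}
  {w₁ : FreeGroup α} {w₂ : FreeGroup β}

/-- A common bound for finitely many group elements. -/
theorem exists_bound_finset (h : IsAmalgam ιA ιB w₁ w₂) (ρ : G →* (ℚ ≃o ℚ)) (S : Finset G)
    (x : ℚ) : ∃ e, ∀ M, e ≤ M → ∀ ρ', AgreeOn ιA ιB M ρ ρ' → ∀ g ∈ S, ρ' g x = ρ g x := by
  choose e he using fun g => h.exists_bound ρ g x
  obtain ⟨m, hm⟩ := (S.image e).bddAbove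
  refine ⟨m, fun M hM ρ' hρ' g hg => he g M (le_trans (hm ?_) hM) ρ' hρ'⟩
  exact Finset.mem_coe.2 (Finset.mem_image_of_mem e hg)

/-- If, arbitrarily far up, the amalgamated element `w` moves some element up, then every
neighbourhood of the left order contains one for which the powers of `w` push some element above
any given one. -/
theorem exists_cofinal_order [Countable G] (h : IsAmalgam ιA ιB w₁ w₂) (hw₁ : w₁ ≠ 1)
    (hw₂ : w₂ ≠ 1) (hw : ιA w₁ ≠ 1) (P : LeftOrder G) (S : Finset G) (hS : ∀ g ∈ S, P.lt 1 g)
    (hup : ∀ k, ∃ g, P.le k g ∧ P.lt g (ιA w₁ * g)) :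
    ∃ Q : LeftOrder G, (∀ g ∈ S, Q.lt 1 g) ∧ ∃ g, ∀ k, ∃ N : ℕ, Q.lt k (ιA w₁ ^ N * g) := by
  obtain ⟨u, c₁, l₁, s₁, rfl, hs₁⟩ := exists_cyclicReading w₁ hw₁
  obtain ⟨v, c₂, l₂, s₂, rfl, hs₂⟩ := exists_cyclicReading w₂ hw₂
  have h' := h.conj
  have hcw : (ιA.comp (MulAut.conj u).toMonoidHom) c₁ = ιA (u * c₁ * u⁻¹) := rfl
  rw [← hcw] at hup hw ⊢
  clear hcw h
  generalize ιA.comp (MulAut.conj u).toMonoidHom = κA at *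
  generalize ιB.comp (MulAut.conj v).toMonoidHom = κB at *
  obtain ⟨ρ, x₀, hρ, -, hunb, -⟩ := P.exists_action hw
  obtain ⟨e, he⟩ := h'.exists_bound_finset ρ S x₀
  obtain ⟨k, hk⟩ := hunb e
  obtain ⟨g₀, hkg, hg₀⟩ := hup k
  -- `M` is a point of the orbit of `x₀` moved up by `w`, so far up that a modification above `M`
  -- does not affect the positivity of the elements of `S`.
  set M := ρ g₀ x₀ with hMdef
  have heM : e ≤ M := by
    refine hk.le.trans ?_
    rcases eq_or_ne k g₀ with rfl | hne
    · exact le_rfl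
    · exact (hρ _ _ ⟨hkg, hne⟩).le
  have hM : M < ρ (κA c₁) M := by
    have := hρ _ _ hg₀
    rwa [map_mul, RelIso.mul_apply] at this
  have hA : FreeGroup.lift (fun a => ρ (κA (FreeGroup.of a))) c₁ = ρ (κA c₁) := by
    have : FreeGroup.lift (fun a => ρ (κA (FreeGroup.of a))) = ρ.comp κA := by ext1 a; simp
    rw [this]; rfl
  have hB : FreeGroup.lift (fun b => ρ (κB (FreeGroup.of b))) c₂ = ρ (κA c₁) := by
    have : FreeGroup.lift (fun b => ρ (κB (FreeGroup.of b))) = ρ.comp κB := by ext1 b; simp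
    rw [this, h'.comm]; rfl
  obtain ⟨f, F1, F2, -, F4⟩ := hs₁.exists_cofinal _ M (by rwa [hA])
  obtain ⟨g, G1, G2, -, G4⟩ := hs₂.exists_cofinal _ M (by rwa [hB])
  rw [hA] at F2
  rw [hB] at G2
  obtain ⟨ρ', R1, R2⟩ := h'.exists_modified ρ M hM f g F1 G1 F2 G2
    (fun x => ⟨fun _ => (F4 x).imp fun n hn => hn.le, fun _ => (G4 x).imp fun n hn => hn.le⟩)
    (fun x hx => by obtain ⟨n, hn⟩ := G4 x; exact absurd hn (hx n).not_gt)
  refine ⟨P.ofAction ρ' x₀, fun g hg => P.ofAction_lt ρ' ?_, ?_⟩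
  · rw [he M heM ρ' R1 g hg, map_one]
    have := hρ _ _ (hS g hg)
    rwa [map_one] at this
  · obtain ⟨g₁, hg₁⟩ := hunb M
    obtain ⟨g, hg⟩ := h'.exists_lt_of_agreeOn R1 hg₁
    refine ⟨g, fun k => ?_⟩
    obtain ⟨N, hN⟩ := F4 (ρ' k x₀)
    refine ⟨N, P.ofAction_lt ρ' (hN.trans_le ?_)⟩
    rw [map_mul, map_pow, R2, RelIso.mul_apply]
    exact (FreeGroup.lift f c₁ ^ N).monotone hg.le

/-- If the powers of the amalgamated element `w` push `g₀` above any given element, and the first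
free group has a nontrivial homomorphism to `ℤ` vanishing on `w₁`, then every neighbourhood of the
left order contains one for which this fails. -/
theorem exists_not_cofinal_order [Countable G] (h : IsAmalgam ιA ιB w₁ w₂) (hw₁ : w₁ ≠ 1)
    (hw₂ : w₂ ≠ 1) (hw : ιA w₁ ≠ 1) (φ : α → Multiplicative ℤ) {a₀ : α} (ha₀ : φ a₀ ≠ 1)
    (hφ : FreeGroup.lift φ w₁ = 1) (P : LeftOrder G) (S : Finset G) (hS : ∀ g ∈ S, P.lt 1 g)
    {g₀ : G} (hg₀ : ∀ k, ∃ N : ℕ, P.lt k (ιA w₁ ^ N * g₀)) :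
    ∃ Q : LeftOrder G, (∀ g ∈ S, Q.lt 1 g) ∧ ∃ k, ∀ N : ℕ, Q.lt (ιA w₁ ^ N * g₀) k := by
  classical
  obtain ⟨u, c₁, l₁, s₁, rfl, hs₁⟩ := exists_cyclicReading w₁ hw₁
  obtain ⟨v, c₂, l₂, s₂, rfl, hs₂⟩ := exists_cyclicReading w₂ hw₂
  have hφ' : FreeGroup.lift φ c₁ = 1 := by
    rw [map_mul, map_mul, map_inv, mul_comm, inv_mul_cancel_left] at hφ
    exact hφ
  have h' := h.conj
  have hcw : (ιA.comp (MulAut.conj u).toMonoidHom) c₁ = ιA (u * c₁ * u⁻¹) := rfl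
  rw [← hcw] at hg₀ hw ⊢
  clear hcw h
  generalize ιA.comp (MulAut.conj u).toMonoidHom = κA at *
  generalize ιB.comp (MulAut.conj v).toMonoidHom = κB at *
  obtain ⟨ρ, x₀, hρ, -, hunb, -⟩ := P.exists_action hw
  obtain ⟨e, he⟩ := h'.exists_bound_finset ρ (insert g₀ S) x₀
  set W := ρ (κA c₁) with hW
  set z := ρ g₀ x₀ with hz
  have hWz : ∀ N : ℕ, ρ (κA c₁ ^ N * g₀) x₀ = (W ^ N) z := fun N => by
    rw [map_mul, map_pow, RelIso.mul_apply]
  have hcof : ∀ x, ∃ N : ℕ, x < (W ^ N) z := fun x => by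
    obtain ⟨k, hk⟩ := hunb x
    obtain ⟨N, hN⟩ := hg₀ k
    exact ⟨N, by rw [← hWz]; exact hk.trans (hρ _ _ hN)⟩
  have hzW : z < W z := by
    by_contra hcon
    have hanti : ∀ N : ℕ, (W ^ N) z ≤ z := by
      intro N
      induction N with
      | zero => simp
      | succ N ih =>
        rw [pow_succ, RelIso.mul_apply]
        exact ((W ^ N).monotone (not_lt.1 hcon)).trans ih
    obtain ⟨N, hN⟩ := hcof z
    exact hN.not_ge (hanti N)
  obtain ⟨N₀, hN₀⟩ := hcof e
  -- `M` is so far up that a modification above it affects neither the image of `x₀` under `g₀` nor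
  -- the positivity of the elements of `S`.
  set M := (W ^ N₀) z with hMdef
  have hM : M < W M := by
    have : W M = (W ^ N₀) (W z) := by
      have e1 : (W ^ (N₀ + 1)) z = W M := by rw [pow_succ', RelIso.mul_apply]
      have e2 : (W ^ (N₀ + 1)) z = (W ^ N₀) (W z) := by rw [pow_succ, RelIso.mul_apply]
      exact e1.symm.trans e2
    rw [this]
    exact (W ^ N₀).strictMono hzW
  have hA : FreeGroup.lift (fun a => ρ (κA (FreeGroup.of a))) c₁ = W := by
    have : FreeGroup.lift (fun a => ρ (κA (FreeGroup.of a))) = ρ.comp κA := by ext1 a; simp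
    rw [this]; rfl
  have hB : FreeGroup.lift (fun b => ρ (κB (FreeGroup.of b))) c₂ = W := by
    have : FreeGroup.lift (fun b => ρ (κB (FreeGroup.of b))) = ρ.comp κB := by ext1 b; simp
    rw [this, hW, h'.comm]; rfl
  obtain ⟨TA, hTA⟩ := hs₁.exists_fibered (fun a => ρ (κA (FreeGroup.of a))) M (by rwa [hA]) φ hφ'
  -- On the side of the second free group the trivial homomorphism is used: `w` then acts in the
  -- same way on the higher fibers on both sides.
  obtain ⟨TB, hTB⟩ := hs₂.exists_fibered (fun b => ρ (κB (FreeGroup.of b))) M (by rwa [hB])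
    (fun _ => 1) (by
      have : FreeGroup.lift (fun _ : β => (1 : Multiplicative ℤ)) = 1 := by ext1 b; simp
      rw [this]; rfl)
  obtain ⟨θ, hθ⟩ := exists_fiber_iso (max TA TB)
  obtain ⟨f, F1, F2, F3, F4, F5⟩ := hTA θ ((le_max_left _ _).trans_lt hθ)
  obtain ⟨g, G1, G2, G3, G4, -⟩ := hTB θ ((le_max_right _ _).trans_lt hθ)
  rw [hA] at F2
  rw [hB] at G2
  obtain ⟨ρ', R1, R2⟩ := h'.exists_modified ρ M hM f g F1 G1 F2 G2
    (fun x => (G3 x).trans (F3 x).symm) (fun x hx => by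
      have hx' : ∀ r, ¬ x ≤ θ (toLex (0, r)) := fun r hr => by
        obtain ⟨n, hn⟩ := (G3 x).2 ⟨r, hr⟩
        exact (hx n).not_ge hn
      obtain ⟨k, r, rfl⟩ : ∃ k r, x = θ (toLex (k, r)) :=
        ⟨(ofLex (θ.symm x)).1, (ofLex (θ.symm x)).2, by simp⟩
      have hk : 0 < k := by
        by_contra hk
        refine hx' r (θ.monotone ?_)
        rw [Prod.Lex.toLex_le_toLex]
        rcases (not_lt.1 hk).lt_or_eq with hk | hk
        · exact Or.inl hk
        · exact Or.inr ⟨hk, le_rfl⟩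
      rw [G4 k r hk, F4 k r hk])
  have hstart : ρ' g₀ x₀ = z := he M hN₀.le ρ' R1 g₀ (Finset.mem_insert_self _ _)
  -- Below `M` the element `w` acts as before, so the modified orbit of `z` still passes
  -- through `M`.
  have hpass : ∀ N ≤ N₀, (FreeGroup.lift f c₁ ^ N) z = (W ^ N) z := by
    intro N
    induction N with
    | zero => simp
    | succ N ih =>
      intro hN
      rw [pow_succ', RelIso.mul_apply, ih (by omega), pow_succ', RelIso.mul_apply]
      exact F2 _ (RelIso.pow_apply_mono hzW.le (show N ≤ N₀ by omega))
  refine ⟨P.ofAction ρ' x₀, fun g hg => P.ofAction_lt ρ' ?_, ?_⟩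
  · rw [he M hN₀.le ρ' R1 g (Finset.mem_insert_of_mem hg), map_one]
    have := hρ _ _ (hS g hg)
    rwa [map_one] at this
  · obtain ⟨b, n, hb⟩ := F5 a₀ ha₀
    refine ⟨κA b * (κA c₁ ^ (n + N₀) * g₀), fun N => P.ofAction_lt ρ' ?_⟩
    have e1 : ρ' (κA b * (κA c₁ ^ (n + N₀) * g₀)) x₀ =
        FreeGroup.lift f b ((FreeGroup.lift f c₁ ^ n) M) := by
      rw [map_mul, map_mul, map_pow, R2, R2, RelIso.mul_apply, RelIso.mul_apply, hstart, pow_add,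
        RelIso.mul_apply, hpass N₀ le_rfl]
    have e2 : ρ' (κA c₁ ^ N * g₀) x₀ = (FreeGroup.lift f c₁ ^ N) z := by
      rw [map_mul, map_pow, R2, RelIso.mul_apply, hstart]
    have e3 : (FreeGroup.lift f c₁ ^ N) z ≤ (FreeGroup.lift f c₁ ^ N) M :=
      (FreeGroup.lift f c₁ ^ N).monotone (RelIso.pow_apply_mono hzW.le (Nat.zero_le N₀))
    obtain ⟨r, hr⟩ := (F3 _).1 ⟨N, e3⟩
    rw [e1, e2]
    exact hr.trans_lt (hb r)

/-- In an amalgam of two free groups along nontrivial elements, the first free group being of rank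
at least two, finitely many positive elements never determine a left order. -/
theorem exists_ne_of_finset [Countable G] (h : IsAmalgam ιA ιB w₁ w₂) (hw₁ : w₁ ≠ 1)
    (hw₂ : w₂ ≠ 1) (hw : ιA w₁ ≠ 1) (φ : α → Multiplicative ℤ) {a₀ : α} (ha₀ : φ a₀ ≠ 1)
    (hφ : FreeGroup.lift φ w₁ = 1) (P : LeftOrder G) (S : Finset G) (hS : ∀ g ∈ S, P.lt 1 g) :
    ∃ Q : LeftOrder G, (∀ g ∈ S, Q.lt 1 g) ∧ Q ≠ P := by
  -- In both cases below, `w` may be replaced by its inverse.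
  have hcof : ∀ (v₁ : FreeGroup α) (v₂ : FreeGroup β), IsAmalgam ιA ιB v₁ v₂ → v₁ ≠ 1 → v₂ ≠ 1 →
      ιA v₁ ≠ 1 → FreeGroup.lift φ v₁ = 1 → (∃ g, ∀ k, ∃ N : ℕ, P.lt k (ιA v₁ ^ N * g)) →
      ∃ Q : LeftOrder G, (∀ g ∈ S, Q.lt 1 g) ∧ Q ≠ P := by
    rintro v₁ v₂ hv hv₁ hv₂ hv1 hφv ⟨g₀, hg₀⟩
    obtain ⟨Q, hQ, k, hk⟩ := hv.exists_not_cofinal_order hv₁ hv₂ hv1 φ ha₀ hφv P S hS hg₀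
    refine ⟨Q, hQ, ?_⟩
    rintro rfl
    obtain ⟨N, hN⟩ := hg₀ k
    exact Q.not_lt_of_lt hN (hk N)
  have hncof : ∀ (v₁ : FreeGroup α) (v₂ : FreeGroup β), IsAmalgam ιA ιB v₁ v₂ → v₁ ≠ 1 → v₂ ≠ 1 →
      ιA v₁ ≠ 1 → (¬ ∃ g, ∀ k, ∃ N : ℕ, P.lt k (ιA v₁ ^ N * g)) →
      (∀ k, ∃ g, P.le k g ∧ P.lt g (ιA v₁ * g)) →
      ∃ Q : LeftOrder G, (∀ g ∈ S, Q.lt 1 g) ∧ Q ≠ P := by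
    intro v₁ v₂ hv hv₁ hv₂ hv1 hn hup
    obtain ⟨Q, hQ, hQ'⟩ := hv.exists_cofinal_order hv₁ hv₂ hv1 P S hS hup
    refine ⟨Q, hQ, ?_⟩
    rintro rfl
    exact hn hQ'
  have hi1 : w₁⁻¹ ≠ 1 := inv_ne_one.2 hw₁
  have hi2 : w₂⁻¹ ≠ 1 := inv_ne_one.2 hw₂
  have hi3 : ιA w₁⁻¹ ≠ 1 := by rw [map_inv]; exact inv_ne_one.2 hw
  have hi4 : FreeGroup.lift φ w₁⁻¹ = 1 := by rw [map_inv, hφ, inv_one]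
  by_cases hc1 : ∃ g, ∀ k, ∃ N : ℕ, P.lt k (ιA w₁ ^ N * g)
  · exact hcof w₁ w₂ h hw₁ hw₂ hw hφ hc1
  by_cases hc2 : ∃ g, ∀ k, ∃ N : ℕ, P.lt k (ιA w₁⁻¹ ^ N * g)
  · exact hcof _ _ h.inv hi1 hi2 hi3 hi4 hc2
  by_cases hup : ∀ k, ∃ g, P.le k g ∧ P.lt g (ιA w₁ * g)
  · exact hncof w₁ w₂ h hw₁ hw₂ hw hc1 hup
  · refine hncof _ _ h.inv hi1 hi2 hi3 hc2 fun k => ?_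
    push Not at hup
    obtain ⟨k₀, hk₀⟩ := hup
    have hdown : ∀ g, P.le k₀ g → P.lt g (ιA w₁⁻¹ * g) := by
      intro g hg
      rcases P.lt_trichotomy g (ιA w₁ * g) with h1 | h1 | h1
      · exact absurd h1 (hk₀ g hg)
      · exact absurd (mul_eq_right.1 h1.symm) hw
      · have := P.mul_lt_mul_left (ιA w₁)⁻¹ h1
        rwa [inv_mul_cancel_left, ← map_inv] at this
    rcases P.le_total k k₀ with h1 | h1
    · exact ⟨k₀, h1, hdown _ (P.le_refl _)⟩
    · exact ⟨k, P.le_refl _, hdown _ h1⟩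

end IsAmalgam

/-- An element of a free group of rank at least two is in the kernel of some nontrivial homomorphism
to `ℤ`. -/
theorem FreeGroup.exists_hom_int {α : Type*} {a b : α} (hab : a ≠ b) (w : FreeGroup α) :
    ∃ (φ : α → Multiplicative ℤ) (a₀ : α), φ a₀ ≠ 1 ∧ FreeGroup.lift φ w = 1 := by
  classical
  let δ : α → α → Multiplicative ℤ := fun i j => if j = i then Multiplicative.ofAdd 1 else 1
  set x := FreeGroup.lift (δ a) w with hx
  set y := FreeGroup.lift (δ b) w with hy
  by_cases h : x = 1
  · exact ⟨δ a, a, by simp [δ], h⟩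
  · refine ⟨fun j => δ a j ^ y.toAdd * δ b j ^ (-x.toAdd), b, ?_, ?_⟩
    · simpa [δ, hab.symm] using h
    · have hlift : FreeGroup.lift (fun j => δ a j ^ y.toAdd * δ b j ^ (-x.toAdd)) =
          (zpowGroupHom y.toAdd).comp (FreeGroup.lift (δ a)) *
            (zpowGroupHom (-x.toAdd)).comp (FreeGroup.lift (δ b)) := by
        ext1 j
        simp
      rw [hlift, MonoidHom.mul_apply, MonoidHom.comp_apply, MonoidHom.comp_apply, ← hx, ← hy]
      apply Multiplicative.toAdd.injective
      simp [mul_comm]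

/-! ### Closed subsets of the Cantor space without isolated points -/

/-- The coordinate `n` is a branching level of the point `x` of `X`: both values at `n` occur among
the points of `X` agreeing with `x` before `n`. -/
def IsBranching (X : Set (ℕ → Bool)) (x : ℕ → Bool) (n : ℕ) : Prop :=
  ∀ b, ∃ y ∈ X, (∀ m < n, y m = x m) ∧ y n = b

section IsBranching

theorem isOpen_apply_eq (n : ℕ) (b : Bool) : IsOpen {x : ℕ → Bool | x n = b} := by
  have : {x : ℕ → Bool | x n = b} = (fun x => x n) ⁻¹' {b} := by ext; rfl
  rw [this]
  exact (isOpen_discrete {b}).preimage (continuous_apply n)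

variable {X : Set (ℕ → Bool)}

theorem isBranching_congr {x x' : ℕ → Bool} {n : ℕ} (h : ∀ m < n, x m = x' m) :
    IsBranching X x n ↔ IsBranching X x' n := by
  constructor
  · intro hb b
    obtain ⟨y, hy, h1, h2⟩ := hb b
    exact ⟨y, hy, fun m hm => (h1 m hm).trans (h m hm), h2⟩
  · intro hb b
    obtain ⟨y, hy, h1, h2⟩ := hb b
    exact ⟨y, hy, fun m hm => (h1 m hm).trans (h m hm).symm, h2⟩

theorem isBranching_of_ne {x y : ℕ → Bool} (hx : x ∈ X) (hy : y ∈ X) {n : ℕ}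
    (h : ∀ m < n, y m = x m) (hn : y n ≠ x n) : IsBranching X x n := by
  intro b
  rcases eq_or_ne b (x n) with rfl | hb
  · exact ⟨x, hx, fun _ _ => rfl, rfl⟩
  · exact ⟨y, hy, h, by revert hn hb; cases b <;> cases y n <;> cases x n <;> simp⟩

theorem infinite_isBranching (hX : ∀ x ∈ X, ∀ N, ∃ y ∈ X, y ≠ x ∧ ∀ n < N, y n = x n)
    {x : ℕ → Bool} (hx : x ∈ X) : (Set.ofPred (IsBranching X x)).Infinite := by
  classical
  refine Set.infinite_of_forall_exists_gt fun N => ?_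
  obtain ⟨y, hy, hne, hN⟩ := hX x hx (N + 1)
  have hex : ∃ n, y n ≠ x n := Function.ne_iff.1 hne
  refine ⟨Nat.find hex, isBranching_of_ne hx hy (fun m hm => ?_) (Nat.find_spec hex), ?_⟩
  · exact not_not.1 (Nat.find_min hex hm)
  · by_contra hcon
    exact Nat.find_spec hex (hN _ (by omega))

/-- The first branching levels of a point depend only on its coordinates before them. -/
theorem nth_isBranching_congr (hX : ∀ x ∈ X, ∀ N, ∃ y ∈ X, y ≠ x ∧ ∀ n < N, y n = x n)
    {x x' : ℕ → Bool} (hx : x ∈ X) {i : ℕ}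
    (h : ∀ m < Nat.nth (IsBranching X x) i, x m = x' m) {j : ℕ} (hj : j ≤ i) :
    Nat.nth (IsBranching X x') j = Nat.nth (IsBranching X x) j := by
  classical
  have hinf := infinite_isBranching hX hx
  have hle := Nat.nth_monotone hinf hj
  set n := Nat.nth (IsBranching X x) j with hn
  have hcount : Nat.count (IsBranching X x') n = j := by
    rw [← Nat.count_nth_of_infinite hinf j, ← hn, Nat.count_eq_card_filter_range,
      Nat.count_eq_card_filter_range]
    congr 1
    refine Finset.filter_congr fun m hm => ?_
    rw [Finset.mem_range] at hm
    exact (isBranching_congr fun k hk => h k (by omega)).symm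
  have hbr : IsBranching X x' n :=
    (isBranching_congr fun k hk => h k (by omega)).1 (Nat.nth_mem_of_infinite hinf j)
  rw [← hcount, Nat.nth_count hbr]

/-- A nonempty closed subset of `ℕ → Bool` without isolated points is homeomorphic to `ℕ → Bool`:
send a point to the sequence of its values at its branching levels. -/
theorem nonempty_homeomorph_of_perfect (hclosed : IsClosed X) (hne : X.Nonempty)
    (hX : ∀ x ∈ X, ∀ N, ∃ y ∈ X, y ≠ x ∧ ∀ n < N, y n = x n) :
    Nonempty (X ≃ₜ (ℕ → Bool)) := by
  classical
  have hcomp : CompactSpace X := isCompact_iff_compactSpace.1 hclosed.isCompact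
  let F : X → (ℕ → Bool) := fun x i => x.1 (Nat.nth (IsBranching X x.1) i)
  have hcont : Continuous F := by
    refine continuous_pi fun i => continuous_iff_continuousAt.2 fun x => ?_
    set N := Nat.nth (IsBranching X x.1) i with hN
    have hev : ∀ᶠ x' : X in nhds x, ∀ m ∈ Set.Iic N, x'.1 m = x.1 m := by
      rw [Filter.eventually_all_finite (Set.finite_Iic N)]
      intro m _
      have hc : Continuous fun x' : X => x'.1 m := (continuous_apply m).comp continuous_subtype_val
      exact (isOpen_discrete {x.1 m}).preimage hc |>.mem_nhds rfl
    have hloc : (fun _ => F x i) =ᶠ[nhds x] fun x' => F x' i := by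
      filter_upwards [hev] with x' hx'
      have := nth_isBranching_congr hX x.2 (x' := x'.1) (i := i)
        (fun m hm => (hx' m hm.le).symm) le_rfl
      simp only [F]
      rw [this]
      exact (hx' _ (Set.mem_Iic.2 le_rfl)).symm
    exact continuousAt_const.congr hloc
  have hinj : Function.Injective F := by
    intro x x' hxx
    by_contra hcon
    have hex : ∃ n, x.1 n ≠ x'.1 n := Function.ne_iff.1 fun h => hcon (Subtype.ext h)
    set n := Nat.find hex with hn
    have hmin : ∀ m < n, x.1 m = x'.1 m := fun m hm => not_not.1 (Nat.find_min hex hm)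
    have hbr : IsBranching X x.1 n :=
      isBranching_of_ne x.2 x'.2 (fun m hm => (hmin m hm).symm) (Nat.find_spec hex).symm
    have e1 : Nat.nth (IsBranching X x.1) (Nat.count (IsBranching X x.1) n) = n :=
      Nat.nth_count hbr
    have e2 := nth_isBranching_congr hX x.2 (x' := x'.1) (i := Nat.count (IsBranching X x.1) n)
      (fun m hm => hmin m (by rwa [e1] at hm)) le_rfl
    have := congrFun hxx (Nat.count (IsBranching X x.1) n)
    simp only [F] at this
    rw [e2, e1] at this
    exact Nat.find_spec hex this
  have hdense : ∀ z : ℕ → Bool, ∀ k : ℕ, ∃ x : X, ∀ i < k, F x i = z i := by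
    intro z k
    induction k with
    | zero => exact ⟨⟨_, hne.some_mem⟩, by simp⟩
    | succ k ih =>
      obtain ⟨x, hx⟩ := ih
      have hinf := infinite_isBranching hX x.2
      set N := Nat.nth (IsBranching X x.1) k with hN
      obtain ⟨y, hy, h1, h2⟩ := Nat.nth_mem_of_infinite hinf k (z k)
      have hnth : ∀ i ≤ k, Nat.nth (IsBranching X y) i = Nat.nth (IsBranching X x.1) i :=
        fun i hi => nth_isBranching_congr hX x.2 (fun m hm => (h1 m hm).symm) hi
      refine ⟨⟨y, hy⟩, fun i hi => ?_⟩
      simp only [F]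
      rw [hnth i (by omega)]
      rcases (Nat.lt_succ_iff.1 hi).lt_or_eq with hi | rfl
      · rw [h1 _ (Nat.nth_strictMono hinf hi)]
        exact hx i hi
      · exact h2
  have hsurj : Function.Surjective F := by
    intro z
    choose x hx using hdense z
    have hlim : Filter.Tendsto (fun k => F (x k)) Filter.atTop (nhds z) := by
      rw [tendsto_pi_nhds]
      intro i
      refine tendsto_const_nhds.congr' ?_
      filter_upwards [Filter.eventually_gt_atTop i] with k hk
      exact (hx k i hk).symm
    exact (isCompact_range hcont).isClosed.mem_of_tendsto hlim
      (Filter.Eventually.of_forall fun k => Set.mem_range_self _)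
  exact ⟨hcont.homeoOfEquivCompactToT2 (f := Equiv.ofBijective F ⟨hinj, hsurj⟩)⟩

end IsBranching

/-! ### The topology of the space of left orders -/

namespace LeftOrder

variable {G : Type*} [Group G]

/-- An isolated left order is determined by finitely many of its positive elements. -/
theorem exists_finset_of_isOpen {P : LeftOrder G} (h : IsOpen ({P} : Set (LeftOrder G))) :
    ∃ S : Finset G, (∀ g ∈ S, P.lt 1 g) ∧ ∀ Q : LeftOrder G, (∀ g ∈ S, Q.lt 1 g) → Q = P := by
  classical
  obtain ⟨_, ⟨f, ⟨hf, hsub⟩, rfl⟩, hPf, hfP⟩ :=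
    (TopologicalSpace.isTopologicalBasis_of_subbasis
      (rfl : (instTopologicalSpace : TopologicalSpace (LeftOrder G)) = _)).exists_subset_of_mem_open
      (Set.mem_singleton P) h
  choose! c hc using hsub
  refine ⟨hf.toFinset.image c, fun g hg => ?_, fun Q hQ => hfP fun U hU => ?_⟩
  · obtain ⟨U, hU, rfl⟩ := Finset.mem_image.1 hg
    have hU' := hf.mem_toFinset.1 hU
    have := hPf U hU'
    rwa [hc hU'] at this
  · rw [hc hU]
    exact hQ _ (Finset.mem_image_of_mem c (hf.mem_toFinset.2 hU))

theorem lt_iff_one_lt (P : LeftOrder G) {a b : G} : P.lt a b ↔ P.lt 1 (a⁻¹ * b) := by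
  constructor
  · intro h
    simpa using P.mul_lt_mul_left a⁻¹ h
  · intro h
    simpa using P.mul_lt_mul_left a h

theorem ext_of_one_lt {P Q : LeftOrder G} (h : ∀ g, P.lt 1 g ↔ Q.lt 1 g) : P = Q := by
  ext a b
  rw [← not_iff_not, ← P.lt_iff_not_le, ← Q.lt_iff_not_le, P.lt_iff_one_lt, Q.lt_iff_one_lt, h]

theorem not_one_lt_iff (P : LeftOrder G) {g : G} (hg : g ≠ 1) : ¬ P.lt 1 g ↔ P.lt 1 g⁻¹ := by
  have h1 : P.lt g 1 ↔ P.lt 1 g⁻¹ := by rw [lt_iff_one_lt, mul_one]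
  rw [← h1]
  constructor
  · intro h
    exact ((P.lt_trichotomy 1 g).resolve_left h).resolve_left (Ne.symm hg)
  · intro h h'
    exact P.not_lt_of_lt h h'

theorem isOpen_one_lt (g : G) : IsOpen {P : LeftOrder G | P.lt 1 g} :=
  TopologicalSpace.isOpen_generateFrom_of_mem ⟨g, rfl⟩

theorem isClosed_one_lt (g : G) : IsClosed {P : LeftOrder G | P.lt 1 g} := by
  rw [← isOpen_compl_iff]
  rcases eq_or_ne g 1 with rfl | hg
  · convert isOpen_univ
    ext P
    simp [lt]
  · convert isOpen_one_lt g⁻¹ using 1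
    ext P
    exact P.not_one_lt_iff hg

open Classical in
/-- The left order `P` as the indicator sequence of its positive elements along an enumeration `e`
of the group. -/
noncomputable def code (e : ℕ → G) (P : LeftOrder G) : ℕ → Bool := fun n => decide (P.lt 1 (e n))

theorem code_eq_true {e : ℕ → G} {P : LeftOrder G} {n : ℕ} :
    P.code e n = true ↔ P.lt 1 (e n) := by
  simp [code]

theorem code_eq_false {e : ℕ → G} {P : LeftOrder G} {n : ℕ} :
    P.code e n = false ↔ ¬ P.lt 1 (e n) := by
  simp [code]

theorem continuous_code (e : ℕ → G) : Continuous (code e) := by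
  refine continuous_pi fun n => (continuous_bool_rng true).2 ?_
  have : (fun P : LeftOrder G => P.code e n) ⁻¹' {true} = {P | P.lt 1 (e n)} := by
    ext P
    exact code_eq_true
  rw [this]
  exact ⟨isClosed_one_lt _, isOpen_one_lt _⟩

/-- The conditions on a sequence of signs to be the code of a left order. -/
theorem mem_range_code_iff {e : ℕ → G} (he : Function.Surjective e) (x : ℕ → Bool) :
    x ∈ Set.range (code e) ↔
      (∀ n m, e n = e m → x n = x m) ∧ (∀ n, e n = 1 → x n = false) ∧
        (∀ n m, e n ≠ 1 → e m = (e n)⁻¹ → x m = !x n) ∧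
        ∀ n m k, e k = e n * e m → (x n && x m && !x k) = false := by
  constructor
  · rintro ⟨P, rfl⟩
    refine ⟨fun n m h => by unfold code; rw [h], fun n h => ?_, fun n m h h' => ?_,
      fun n m k h => ?_⟩
    · rw [code_eq_false, h]
      exact fun h => h.2 rfl
    · have := P.not_one_lt_iff h
      by_cases hn : P.lt 1 (e n) <;> simp_all [code]
    · by_cases hn : P.lt 1 (e n)
      · by_cases hm : P.lt 1 (e m)
        · have := P.mul_lt_mul_left (e n) hm
          rw [mul_one] at this
          have := P.lt_trans hn this
          simp [code, h, this]
        · simp [code, hm]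
      · simp [code, hn]
  · rintro ⟨h1, h2, h3, h4⟩
    choose i hi using he
    have hmul : ∀ a b, x (i a) = true → x (i b) = true → x (i (a * b)) = true := by
      intro a b ha hb
      have := h4 (i a) (i b) (i (a * b)) (by rw [hi, hi, hi])
      simpa [ha, hb] using this
    have hone : x (i 1) = false := h2 _ (hi 1)
    have hinv : ∀ a, a ≠ 1 → x (i a⁻¹) = !x (i a) := fun a ha =>
      h3 _ _ (by rwa [hi]) (by rw [hi, hi])
    let P : LeftOrder G :=
      { le := fun a b => a = b ∨ x (i (a⁻¹ * b)) = true
        le_refl := fun a => Or.inl rfl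
        le_trans := by
          rintro a b c (rfl | h) (rfl | h')
          · exact Or.inl rfl
          · exact Or.inr h'
          · exact Or.inr h
          · refine Or.inr ?_
            have := hmul _ _ h h'
            rwa [mul_assoc, mul_inv_cancel_left] at this
        le_antisymm := by
          rintro a b (rfl | h) (h' | h')
          · rfl
          · rfl
          · exact h'.symm
          · have := hmul _ _ h h'
            rw [mul_assoc, mul_inv_cancel_left, inv_mul_cancel, hone] at this
            exact absurd this (by simp)
        le_total := by
          intro a b
          by_cases hab : a = b
          · exact Or.inl (Or.inl hab)
          · have := hinv (a⁻¹ * b) (fun h => hab (inv_mul_eq_one.1 h))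
            rw [mul_inv_rev, inv_inv] at this
            cases hx : x (i (a⁻¹ * b))
            · exact Or.inr (Or.inr (by rw [this, hx]; rfl))
            · exact Or.inl (Or.inr rfl)
        mul_le_mul_left := by
          rintro g a b (rfl | h)
          · exact Or.inl rfl
          · refine Or.inr ?_
            rwa [mul_inv_rev, mul_assoc, inv_mul_cancel_left] }
    refine ⟨P, funext fun n => ?_⟩
    have hlt : P.lt 1 (e n) ↔ x n = true := by
      have e1 : x (i (1⁻¹ * e n)) = x n := h1 _ _ (by rw [hi]; simp)
      change ((1 = e n ∨ x (i (1⁻¹ * e n)) = true) ∧ 1 ≠ e n) ↔ _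
      rw [e1]
      constructor
      · rintro ⟨h | h, h'⟩
        · exact absurd h h'
        · exact h
      · intro h
        refine ⟨Or.inr h, fun h' => ?_⟩
        rw [h2 n h'.symm] at h
        exact absurd h (by simp)
    rw [Bool.eq_iff_iff, code_eq_true, hlt]

/-- In particular the space of left orders of a countable group is compact, metrizable and totally
disconnected. -/
theorem isClosedEmbedding_code {e : ℕ → G} (he : Function.Surjective e) :
    Topology.IsClosedEmbedding (code e) := by
  refine ⟨⟨⟨_root_.le_antisymm (continuous_code e).le_induced ?_⟩, fun P Q h => ?_⟩, ?_⟩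
  · refine le_generateFrom ?_
    rintro _ ⟨g, rfl⟩
    obtain ⟨n, rfl⟩ := he g
    refine ⟨{x | x n = true}, ?_, ?_⟩
    · exact isOpen_apply_eq n true
    · ext P
      exact code_eq_true
  · refine ext_of_one_lt fun g => ?_
    obtain ⟨n, rfl⟩ := he g
    rw [← code_eq_true, ← code_eq_true, h]
  · have hset : Set.range (code e) = {x | (∀ n m, e n = e m → x n = x m) ∧
        (∀ n, e n = 1 → x n = false) ∧ (∀ n m, e n ≠ 1 → e m = (e n)⁻¹ → x m = !x n) ∧
        ∀ n m k, e k = e n * e m → (x n && x m && !x k) = false} := by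
      ext x
      exact mem_range_code_iff he x
    have hnot : Continuous (fun b : Bool => !b) := continuous_of_discreteTopology
    have hand : ∀ n m k, Continuous fun x : ℕ → Bool => x n && x m && !x k := by
      intro n m k
      have h1 : Continuous fun b : Bool × Bool × Bool => b.1 && b.2.1 && !b.2.2 :=
        continuous_of_discreteTopology
      have h2 : Continuous fun x : ℕ → Bool => (x n, x m, x k) := by fun_prop
      exact h1.comp h2
    rw [hset]
    simp only [Set.ofPred_and, Set.ofPred_forall]
    refine IsClosed.inter ?_ (IsClosed.inter ?_ (IsClosed.inter ?_ ?_))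
    · exact isClosed_iInter fun n => isClosed_iInter fun m => isClosed_iInter fun _ =>
        isClosed_eq (continuous_apply n) (continuous_apply m)
    · exact isClosed_iInter fun n => isClosed_iInter fun _ =>
        isClosed_eq (continuous_apply n) continuous_const
    · exact isClosed_iInter fun n => isClosed_iInter fun m => isClosed_iInter fun _ =>
        isClosed_iInter fun _ => isClosed_eq (continuous_apply m) (hnot.comp (continuous_apply n))
    · exact isClosed_iInter fun n => isClosed_iInter fun m => isClosed_iInter fun k =>
        isClosed_iInter fun _ => isClosed_eq (hand n m k) continuous_const

/-- The space of left orders of a countable group is homeomorphic to the Cantor set as soon as it is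
nonempty and has no isolated points. -/
theorem nonempty_homeomorph_cantorSet [Countable G] [hne : Nonempty (LeftOrder G)]
    (hiso : ∀ P : LeftOrder G, ¬ IsOpen ({P} : Set (LeftOrder G))) :
    Nonempty (LeftOrder G ≃ₜ cantorSet) := by
  obtain ⟨e, he⟩ := exists_surjective_nat G
  have hemb := isClosedEmbedding_code he
  obtain ⟨Φ⟩ := nonempty_homeomorph_of_perfect hemb.isClosed_range (Set.range_nonempty _) (by
    rintro _ ⟨P, rfl⟩ N
    by_contra! hcon
    refine hiso P ?_
    have hopen : IsOpen {x : ℕ → Bool | ∀ n ∈ Set.Iio N, x n = P.code e n} := by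
      simp only [Set.ofPred_forall]
      exact (Set.finite_Iio N).isOpen_biInter fun n _ => isOpen_apply_eq n _
    convert hopen.preimage (continuous_code e)
    ext Q
    refine ⟨?_, fun hQ => ?_⟩
    · rintro rfl
      exact fun n _ => rfl
    · by_contra hQP
      obtain ⟨n, hn, hne⟩ := hcon (Q.code e) ⟨Q, rfl⟩ fun h => hQP (hemb.injective h)
      exact hne (hQ n hn))
  exact ⟨(hemb.isEmbedding.toHomeomorph.trans Φ).trans cantorSetHomeomorphNatToBool.symm⟩

end LeftOrder

/-! ### Left orders on free groups -/

/-- A nontrivial element of a free group acts on `ℚ` as the translation by `1` in some action. -/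
theorem FreeGroup.exists_hom_eq_shiftQ {α : Type*} {w : FreeGroup α} (hw : w ≠ 1) :
    ∃ ρ : FreeGroup α →* (ℚ ≃o ℚ), ρ w = shiftQ := by
  obtain ⟨u, c, l, s, rfl, hs⟩ := exists_cyclicReading w hw
  obtain ⟨τ, -, hτ, -⟩ := hs.exists_translation
  refine ⟨(FreeGroup.lift τ).comp (MulAut.conj u⁻¹).toMonoidHom, ?_⟩
  simpa [mul_assoc] using hτ

theorem FreeGroup.nonempty_leftOrder (α : Type*) [Countable α] :
    Nonempty (LeftOrder (FreeGroup α)) := by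
  have : Countable (FreeGroup α) := Quot.mk_surjective.countable
  refine LeftOrder.nonempty_of_residual fun g hg => ?_
  obtain ⟨ρ, hρ⟩ := FreeGroup.exists_hom_eq_shiftQ hg
  exact ⟨ρ, 0, by simp [hρ]⟩

/-- The action can in addition be chosen to be free: it is the action induced by a left order in
which the powers of `w` are unbounded in both directions. -/
theorem FreeGroup.exists_free_hom_eq_shiftQ {α : Type*} [Countable α] {w : FreeGroup α}
    (hw : w ≠ 1) :
    ∃ ρ : FreeGroup α →* (ℚ ≃o ℚ), ρ w = shiftQ ∧ ∀ g x, ρ g x = x → g = 1 := by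
  have : Countable (FreeGroup α) := Quot.mk_surjective.countable
  obtain ⟨σ, hσ⟩ := FreeGroup.exists_hom_eq_shiftQ hw
  obtain ⟨P⟩ := FreeGroup.nonempty_leftOrder α
  obtain ⟨ρ, x₀, hlt, hfree, htop, hbot⟩ := (P.ofAction σ 0).exists_action hw
  have hσk : ∀ k : ℤ, σ (w ^ k) 0 = k := fun k => by
    rw [map_zpow, hσ, shiftQ_zpow_apply, zero_add]
  have h0 : x₀ < ρ w x₀ := by
    have := hlt 1 w (P.ofAction_lt σ (by rw [_root_.map_one, hσ]; simp))
    simpa using this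
  set t : ℚ ≃o ℚ := OrderIso.addRight x₀ with ht
  have ht0 : t 0 = x₀ := zero_add x₀
  have hk : ∀ k : ℤ, ((t⁻¹ * ρ w * t) ^ k) 0 = ρ (w ^ k) x₀ - x₀ := by
    intro k
    have h1 := conj_zpow (i := k) (a := t⁻¹) (b := ρ w)
    rw [inv_inv] at h1
    rw [h1, RelIso.mul_apply, RelIso.mul_apply, ht0, map_zpow]
    apply t.injective
    rw [RelIso.apply_inv_self]
    exact (sub_add_cancel _ _).symm
  obtain ⟨u, hu⟩ := exists_conj_shiftQ (t⁻¹ * ρ w * t)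
    (by have := hk 1; rw [zpow_one, zpow_one] at this; rw [this]; exact sub_pos.2 h0)
    (fun y => by
      obtain ⟨g, hg⟩ := hbot (y + x₀)
      obtain ⟨k, hk'⟩ := exists_int_lt (σ g 0)
      have := hlt _ _ (P.ofAction_lt σ (a := w ^ k) (b := g) (by rwa [hσk]))
      exact ⟨k, by rw [hk]; linarith⟩)
    (fun y => by
      obtain ⟨g, hg⟩ := htop (y + x₀)
      obtain ⟨k, hk'⟩ := exists_int_gt (σ g 0)
      have := hlt _ _ (P.ofAction_lt σ (a := g) (b := w ^ k) (by rwa [hσk]))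
      exact ⟨k, by rw [hk]; linarith⟩)
  refine ⟨(MulAut.conj (t * u)⁻¹).toMonoidHom.comp ρ, ?_, fun g x hx => ?_⟩
  · rw [← hu]
    simp [mul_assoc]
  · refine hfree g ((t * u) x) ?_
    have h1 : (t * u) (((t * u)⁻¹ * ρ g * (t * u)) x) = (t * u) x := by
      simpa using congrArg (t * u) hx
    rwa [mul_assoc, RelIso.mul_apply (t * u)⁻¹, RelIso.apply_inv_self, RelIso.mul_apply] at h1

/-! ### Left orders on amalgams of groups acting on the rational line -/

theorem map_add_int {c : ℚ ≃o ℚ} (hc : ∀ x, c (x + 1) = c x + 1) (x : ℚ) (j : ℤ) :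
    c (x + j) = c x + j := by
  have h : Commute c shiftQ := by
    ext y
    exact hc y
  have := congrArg (fun f : ℚ ≃o ℚ => f x) (h.zpow_right j).eq
  simpa only [RelIso.mul_apply, shiftQ_zpow_apply] using this

/-- An automorphism of `ℚ` commuting with `x ↦ x + 1`, supported in the translates of `(u, v)`, with
a prescribed value at one point of `(u, v)`. -/
theorem exists_bump {u v z z' : ℚ} (hz : u < z) (hz' : u < z') (hzv : z < v) (hzv' : z' < v)
    (huv : v ≤ u + 1) :
    ∃ k : ℚ ≃o ℚ, (∀ x, k (x + 1) = k x + 1) ∧ k z = z' ∧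
      ∀ x, (∀ j : ℤ, u < x + j → x + j < v → False) → k x = x := by
  obtain ⟨b, hb1, hb2, hb3⟩ := exists_glue_list (OrderIso.refl ℚ) v [(z, z')] (OrderIso.refl ℚ) u
    (by simp [hz, hz', hzv, hzv'])
  have hb1' : ∀ x ≤ u, b x = x := hb1
  have hb3' : ∀ x, v ≤ x → b x = x := hb3
  obtain ⟨f, hf⟩ := exists_piecewise
    (fun n => ((OrderIso.addRight u).trans b).trans (OrderIso.addRight ((n : ℚ) - u)))
    (fun n => by
      change b (1 + u) + (n - u) = b (0 + u) + ((n + 1 : ℤ) - u)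
      rw [hb3' _ (by linarith), hb1' _ (by linarith)]
      push_cast
      ring)
    (fun y => by
      obtain ⟨n, hn⟩ := exists_int_lt y
      refine ⟨n, ?_⟩
      change b (0 + u) + (n - u) ≤ y
      rw [hb1' _ (by linarith)]
      linarith)
    (fun y => by
      obtain ⟨n, hn⟩ := exists_int_gt y
      refine ⟨n, ?_⟩
      change y < b (0 + u) + (n - u)
      rw [hb1' _ (by linarith)]
      linarith)
  have hf' : ∀ x, f x = b (Int.fract x + u) + (⌊x⌋ - u) := fun x => hf x
  set t : ℚ ≃o ℚ := OrderIso.addRight u with ht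
  have htx : ∀ x, t x = x + u := fun x => rfl
  have htx' : ∀ x, t⁻¹ x = x - u := fun x => by
    apply t.injective
    rw [RelIso.apply_inv_self, htx]
    ring
  have hk : ∀ x, (t * f * t⁻¹) x = b (Int.fract (x - u) + u) + ⌊x - u⌋ := fun x => by
    rw [RelIso.mul_apply, RelIso.mul_apply, htx, htx', hf']
    ring
  refine ⟨t * f * t⁻¹, fun x => ?_, ?_, fun x hx => ?_⟩
  · rw [hk, hk, add_sub_right_comm, Int.fract_add_one, Int.floor_add_one]
    push_cast
    ring
  · have h1 : ⌊z - u⌋ = 0 := Int.floor_eq_zero_iff.2 ⟨by linarith, by linarith⟩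
    rw [hk, Int.fract, h1, Int.cast_zero, sub_zero, sub_add_cancel, add_zero]
    exact hb2 (z, z') (by simp)
  · have h2 : Int.fract (x - u) + u = x + (-⌊x - u⌋ : ℤ) := by
      rw [Int.fract]; push_cast; ring
    have h3 : b (Int.fract (x - u) + u) = Int.fract (x - u) + u := by
      rcases (Int.fract_nonneg (x - u)).eq_or_lt with h | h
      · exact hb1' _ (by linarith)
      · refine hb3' _ (not_lt.1 fun h' => hx (-⌊x - u⌋) ?_ ?_)
        · rw [← h2]; linarith
        · rw [← h2]; exact h'
    rw [hk, h3, Int.fract]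
    ring

/-- Immediately to the right of a point there are no translates of finitely many points. -/
theorem exists_gap_right {Z : Set ℚ} (hZ : Z.Finite) {a b : ℚ} (hab : a < b) :
    ∃ b', a < b' ∧ b' ≤ b ∧ ∀ p ∈ Z, ∀ j : ℤ, a < p + j → b' ≤ p + j := by
  induction Z, hZ using Set.Finite.induction_on with
  | empty => exact ⟨b, hab, le_rfl, by simp⟩
  | @insert q Z _ _ ih =>
    obtain ⟨b', h1, h2, h3⟩ := ih
    have h4 : a < q + (⌊a - q⌋ + 1) := by linarith [Int.lt_floor_add_one (a - q)]
    refine ⟨min b' (q + (⌊a - q⌋ + 1)), lt_min h1 h4, (min_le_left _ _).trans h2, ?_⟩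
    rintro p (rfl | hp) j hj
    · refine (min_le_right _ _).trans (add_le_add_right ?_ p)
      have : ⌊a - p⌋ < j := Int.floor_lt.2 (by linarith)
      exact_mod_cast this
    · exact (min_le_left _ _).trans (h3 p hp j hj)

theorem exists_gap_left {Z : Set ℚ} (hZ : Z.Finite) {a b : ℚ} (hab : a < b) :
    ∃ a', a ≤ a' ∧ a' < b ∧ ∀ p ∈ Z, ∀ j : ℤ, p + j < b → p + j ≤ a' := by
  obtain ⟨c, h1, h2, h3⟩ := exists_gap_right (hZ.image Neg.neg) (neg_lt_neg hab)
  refine ⟨-c, by linarith, by linarith, fun p hp j hj => ?_⟩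
  have := h3 _ ⟨p, hp, rfl⟩ (-j) (by push_cast; linarith)
  push_cast at this
  linarith

section FreeActions

variable {ι : Type*} {G : ι → Type*} [∀ i, Group (G i)]

/-- The letters of a free product, acting on `ℚ` through the actions `ρ i` conjugated by
automorphisms `c i`. -/
def twist (ρ : ∀ i, G i →* (ℚ ≃o ℚ)) (c : ι → ℚ ≃o ℚ) (a : Σ i, G i) : ℚ ≃o ℚ :=
  (c a.1)⁻¹ * ρ a.1 a.2 * c a.1

/-- Let groups act freely on `ℚ`, each with an element `φ i 1` acting as `x ↦ x + 1`. For an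
alternating word without letters in the cyclic groups generated by these elements, the actions can
be conjugated by automorphisms commuting with `x ↦ x + 1` so that all the points through which
the word moves some `z` have different classes modulo `ℤ`. When a letter of the `i`-th group is put
in front of the word, the automorphism `c i` is changed by a bump that moves the end point of the
trajectory while fixing the classes of its other points: the classes to be avoided are nowhere
dense. -/
theorem exists_twist_separating (φ : ∀ i, Multiplicative ℤ →* G i) (ρ : ∀ i, G i →* (ℚ ≃o ℚ))
    (hρ : ∀ i, ρ i (φ i (Multiplicative.ofAdd 1)) = shiftQ) (hfree : ∀ i g x, ρ i g x = x → g = 1)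
    (l : List (Σ i, G i)) (hl : l.IsChain fun a b => a.1 ≠ b.1)
    (hlφ : ∀ a ∈ l, a.2 ∉ (φ a.1).range) :
    ∃ (c : ι → ℚ ≃o ℚ) (z : ℚ), (∀ i x, c i (x + 1) = c i x + 1) ∧
      ∀ s t, s <:+ l → t <:+ l → s ≠ t → ∀ j : ℤ,
        (s.map (twist ρ c)).prod z ≠ (t.map (twist ρ c)).prod z + j := by
  classical
  have hρk : ∀ i (k : ℤ), ρ i (φ i (Multiplicative.ofAdd k)) = shiftQ ^ k := by
    intro i k
    rw [← hρ, ← map_zpow, ← map_zpow, ← ofAdd_zsmul, smul_eq_mul, mul_one]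
  induction l with
  | nil =>
    refine ⟨1, 0, fun i x => rfl, fun s t hs ht hst => ?_⟩
    exact absurd ((List.suffix_nil.1 hs).trans (List.suffix_nil.1 ht).symm) hst
  | cons a l ih =>
    obtain ⟨c, z₀, hc, hsep⟩ := ih hl.tail fun b hb => hlφ b (List.mem_cons_of_mem _ hb)
    set i := a.1 with hi
    set q : List (Σ i, G i) → ℚ := fun s => (s.map (twist ρ c)).prod z₀ with hq
    set z := q l with hz
    set Z : Set ℚ := q '' {s | s <:+ l ∧ s ≠ l} with hZ
    have hZfin : Z.Finite := Set.Finite.image _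
      ((List.finite_toSet l.tails).subset fun s hs => (List.mem_tails _ _).2 hs.1)
    have hzZ : ∀ p ∈ Z, ∀ j : ℤ, z ≠ p + j := by
      rintro _ ⟨s, ⟨hs, hsl⟩, rfl⟩ j
      exact hsep l s List.suffix_rfl hs hsl.symm j
    -- `(u, v)` is a neighbourhood of `z` without translates of the other points.
    obtain ⟨u, hu1, hu2, hu3⟩ := exists_gap_left hZfin (show z - 1 / 2 < z by linarith)
    obtain ⟨v, hv1, hv2, hv3⟩ := exists_gap_right hZfin (show z < z + 1 / 2 by linarith)
    -- The new end point of the old trajectory is `z'`, chosen in this neighbourhood so that the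
    -- letter `a` does not move it to a translate of another point.
    obtain ⟨y', hy1, hy2, hy3⟩ := exists_gap_right hZfin ((twist ρ c a).strictMono hv1)
    obtain ⟨y, hy4, hy5⟩ := exists_between hy1
    set z' := (twist ρ c a)⁻¹ y with hz'
    have hFz' : twist ρ c a z' = y := RelIso.apply_inv_self _ _
    have hzz' : z < z' := (twist ρ c a).lt_iff_lt.1 (by rwa [hFz'])
    have hz'v : z' < v := (twist ρ c a).lt_iff_lt.1 (by rw [hFz']; exact hy5.trans_le hy2)
    obtain ⟨k, hk1, hk2, hk3⟩ := exists_bump hu2 (hu2.trans hzz') hv1 hz'v (by linarith)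
    have hkZ : ∀ p ∈ Z, k p = p := fun p hp => hk3 p fun j hj1 hj2 => by
      rcases lt_trichotomy (p + (j : ℚ)) z with h | h | h
      · exact absurd (hu3 p hp j h) (not_le.2 hj1)
      · exact hzZ p hp j h.symm
      · exact absurd (hv3 p hp j h) (not_le.2 hj2)
    have hkZ' : ∀ p ∈ Z, k⁻¹ p = p := fun p hp => by
      apply k.injective
      rw [RelIso.apply_inv_self, hkZ p hp]
    set c' : ι → ℚ ≃o ℚ := Function.update c i (c i * k) with hc'
    have hc'i : c' i = c i * k := Function.update_self ..
    have htwist : ∀ b : Σ i, G i, b.1 = i → twist ρ c' b = k⁻¹ * twist ρ c b * k := by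
      intro b hb
      have h : c' b.1 = c b.1 * k := by rw [hb, hc'i]
      simp only [twist, h, mul_inv_rev, mul_assoc]
    have htwist' : ∀ b : Σ i, G i, b.1 ≠ i → twist ρ c' b = twist ρ c b := by
      intro b hb
      simp only [twist, hc', Function.update_of_ne hb]
    -- The trajectory of the old word does not change.
    have hq' : ∀ s, s <:+ l → (s.map (twist ρ c')).prod z₀ = q s := by
      intro s hs
      induction s with
      | nil => rfl
      | cons b s ihs =>
        have hs' : s <:+ l := (List.suffix_cons b s).trans hs
        have hne : s ≠ l := by
          rintro rfl
          simpa using hs.length_le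
        rw [List.map_cons, List.prod_cons, RelIso.mul_apply, ihs hs']
        have hqb : q (b :: s) = twist ρ c b (q s) := by
          simp only [hq, List.map_cons, List.prod_cons, RelIso.mul_apply]
        by_cases hb : b.1 = i
        · have hne' : b :: s ≠ l := by
            rintro rfl
            exact (List.isChain_cons_cons.1 hl).1 hb.symm
          rw [htwist b hb, RelIso.mul_apply, RelIso.mul_apply, hkZ _ ⟨s, ⟨hs', hne⟩, rfl⟩, ← hqb,
            hkZ' _ ⟨_, ⟨hs, hne'⟩, rfl⟩]
        · rw [htwist' b hb, hqb]
    have hnew : ((a :: l).map (twist ρ c')).prod z₀ = k⁻¹ y := by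
      rw [List.map_cons, List.prod_cons, RelIso.mul_apply, hq' l List.suffix_rfl, htwist a rfl,
        RelIso.mul_apply, RelIso.mul_apply, ← hz, hk2, hFz']
    have hnewsep : ∀ s, s <:+ l → ∀ j : ℤ, k⁻¹ y ≠ q s + j := by
      intro s hs j hj
      have hj' : y = k (q s) + j := by
        rw [← map_add_int hk1, ← hj, RelIso.apply_inv_self]
      by_cases hsl : s = l
      · -- The end point cannot stay in its class because the action is free.
        subst hsl
        rw [← hz, hk2, ← hFz'] at hj'
        simp only [twist, RelIso.mul_apply] at hj'
        set x := c a.1 z' with hx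
        have h1 : ρ a.1 a.2 x = x + j := by
          rw [hx, ← map_add_int (hc a.1), ← hx]
          have := congrArg (c a.1) hj'
          rwa [RelIso.apply_inv_self] at this
        have h2 := hfree a.1 ((φ a.1 (Multiplicative.ofAdd j))⁻¹ * a.2) x (by
          rw [map_mul, RelIso.mul_apply, h1, ← shiftQ_zpow_apply, ← hρk a.1, map_inv,
            RelIso.inv_apply_self])
        exact hlφ a List.mem_cons_self ⟨_, inv_mul_eq_one.1 h2⟩
      · have hmem : q s ∈ Z := ⟨s, ⟨hs, hsl⟩, rfl⟩
        rw [hkZ _ hmem] at hj'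
        exact absurd (hy3 _ hmem j (hj' ▸ hy4)) (not_le.2 (hj' ▸ hy5))
    refine ⟨c', z₀, fun i' x => ?_, fun s t hs ht hst j => ?_⟩
    · by_cases h : i' = i
      · rw [h, hc'i, RelIso.mul_apply, RelIso.mul_apply, hk1, hc]
      · rw [hc', Function.update_of_ne h, hc]
    · rcases List.suffix_cons_iff.1 hs with rfl | hs
      · rcases List.suffix_cons_iff.1 ht with rfl | ht
        · exact absurd rfl hst
        · rw [hnew, hq' t ht]
          exact hnewsep t ht j
      · rcases List.suffix_cons_iff.1 ht with rfl | ht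
        · rw [hnew, hq' s hs]
          intro h
          exact hnewsep s hs (-j) (by rw [h]; push_cast; ring)
        · rw [hq' s hs, hq' t ht]
          exact hsep s t hs ht hst j

/-- If the groups `G i` act freely on `ℚ`, with `φ i 1` acting as `x ↦ x + 1`, then a nontrivial
element of the amalgam of the `G i` along `φ` acts nontrivially in some action of the amalgam. -/
theorem Monoid.PushoutI.exists_hom_apply_ne (φ : ∀ i, Multiplicative ℤ →* G i)
    (hφ : ∀ i, Function.Injective (φ i)) (ρ : ∀ i, G i →* (ℚ ≃o ℚ))
    (hρ : ∀ i, ρ i (φ i (Multiplicative.ofAdd 1)) = shiftQ) (hfree : ∀ i g x, ρ i g x = x → g = 1)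
    {g : Monoid.PushoutI φ} (hg : g ≠ 1) :
    ∃ (f : Monoid.PushoutI φ →* (ℚ ≃o ℚ)) (x : ℚ), f g x ≠ x := by
  classical
  obtain ⟨d⟩ := NormalWord.transversal_nonempty φ hφ
  obtain ⟨w, rfl⟩ : ∃ w : NormalWord d, w.prod = g := NormalWord.equiv.symm.surjective g
  have hlφ : ∀ a ∈ w.toList, a.2 ∉ (φ a.1).range := by
    intro a ha hmem
    refine w.ne_one a ha ?_
    have := (d.compl a.1).1 (a₁ := (⟨a.2, hmem⟩, ⟨1, d.one_mem a.1⟩))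
      (a₂ := (⟨1, one_mem _⟩, ⟨a.2, w.normalized a.1 a.2 ha⟩)) (by simp)
    simpa using congrArg (fun p => (p.1 : G a.1)) this
  obtain ⟨c, z, hc, hsep⟩ := exists_twist_separating φ ρ hρ hfree w.toList w.chain_ne hlφ
  let f : Monoid.PushoutI φ →* (ℚ ≃o ℚ) := Monoid.PushoutI.lift
    (fun i => (MulAut.conj (c i)⁻¹).toMonoidHom.comp (ρ i)) (zpowersHom (ℚ ≃o ℚ) shiftQ) (by
      intro i
      ext1
      have h : shiftQ * c i = c i * shiftQ := by
        ext x
        exact (hc i x).symm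
      simp [hρ, mul_assoc, h])
  have hfw : f w.prod z = (w.toList.map (twist ρ c)).prod z + (w.head.toAdd : ℤ) := by
    have h1 : f (ofCoprodI w.toWord.prod) = (w.toList.map (twist ρ c)).prod := by
      rw [CoprodI.Word.prod, map_list_prod, map_list_prod, List.map_map, List.map_map]
      congr 1
    rw [NormalWord.prod, map_mul, RelIso.mul_apply, h1]
    simp [f, shiftQ_zpow_apply]
  refine ⟨f, z, fun h => ?_⟩
  rw [hfw] at h
  by_cases hw : w.toList = []
  · have hhead : w.head = 1 := by
      rw [hw] at h
      simpa using h
    apply hg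
    rw [NormalWord.prod, hhead, CoprodI.Word.prod, hw]
    simp
  · refine hsep w.toList [] List.suffix_rfl (List.nil_suffix) hw (-w.head.toAdd) ?_
    rw [List.map_nil, List.prod_nil, RelIso.one_apply]
    push_cast
    linarith

end FreeActions

/-! ### The amalgams of two free groups along a cyclic subgroup -/

section FreeAmalgam

variable {n m : ℕ} {w₁ : FreeGroup (Fin n)} {w₂ : FreeGroup (Fin m)}

/-- The homomorphism from the free group of rank `n` to the amalgam. -/
def FreeAmalgam.left (w₁ : FreeGroup (Fin n)) (w₂ : FreeGroup (Fin m)) :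
    FreeGroup (Fin n) →* FreeAmalgam w₁ w₂ :=
  Monoid.PushoutI.of (φ := cyclicMaps w₁ w₂) false

/-- The homomorphism from the free group of rank `m` to the amalgam. -/
def FreeAmalgam.right (w₁ : FreeGroup (Fin n)) (w₂ : FreeGroup (Fin m)) :
    FreeGroup (Fin m) →* FreeAmalgam w₁ w₂ :=
  Monoid.PushoutI.of (φ := cyclicMaps w₁ w₂) true

theorem cyclicMaps_false (k : Multiplicative ℤ) :
    cyclicMaps w₁ w₂ false k = w₁ ^ k.toAdd := rfl

theorem cyclicMaps_true (k : Multiplicative ℤ) :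
    cyclicMaps w₁ w₂ true k = w₂ ^ k.toAdd := rfl

theorem FreeAmalgam.left_eq_base :
    FreeAmalgam.left w₁ w₂ w₁ =
      Monoid.PushoutI.base (cyclicMaps w₁ w₂) (Multiplicative.ofAdd 1) := by
  rw [← Monoid.PushoutI.of_apply_eq_base (cyclicMaps w₁ w₂) false, cyclicMaps_false, toAdd_ofAdd,
    zpow_one]
  rfl

theorem FreeAmalgam.isAmalgam :
    IsAmalgam (FreeAmalgam.left w₁ w₂) (FreeAmalgam.right w₁ w₂) w₁ w₂ where
  comm := by
    rw [FreeAmalgam.left_eq_base, ← Monoid.PushoutI.of_apply_eq_base (cyclicMaps w₁ w₂) true,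
      cyclicMaps_true, toAdd_ofAdd, zpow_one]
    rfl
  gen := by
    rw [eq_top_iff]
    have key : ∀ g : FreeAmalgam w₁ w₂,
        g ∈ (FreeAmalgam.left w₁ w₂).range ⊔ (FreeAmalgam.right w₁ w₂).range := by
      intro g
      induction g using Monoid.PushoutI.induction_on with
      | of i g =>
        cases i
        · exact Subgroup.mem_sup_left ⟨g, rfl⟩
        · exact Subgroup.mem_sup_right ⟨g, rfl⟩
      | base k =>
        rw [← Monoid.PushoutI.of_apply_eq_base (cyclicMaps w₁ w₂) false]
        exact Subgroup.mem_sup_left ⟨_, rfl⟩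
      | mul x y hx hy => exact mul_mem hx hy
    exact fun g _ => key g
  lift {H} _ f g hfg := by
    let F : ∀ b : Bool, FreeGroup (Fin (bif b then m else n)) →* H
      | false => f
      | true => g
    let ρ : FreeAmalgam w₁ w₂ →* H := Monoid.PushoutI.lift F (zpowersHom H (f w₁)) (by
      rintro (_ | _)
      · ext1
        exact (congrArg f (zpow_one w₁)).trans (zpow_one (f w₁)).symm
      · ext1
        exact ((congrArg g (zpow_one w₂)).trans hfg.symm).trans (zpow_one (f w₁)).symm)
    exact ⟨ρ, fun u => Monoid.PushoutI.lift_of F _ _ (i := false) u,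
      fun u => Monoid.PushoutI.lift_of F _ _ (i := true) u⟩

theorem IsAmalgam.countable {α β G : Type*} [Countable α] [Countable β] [Group G]
    {ιA : FreeGroup α →* G} {ιB : FreeGroup β →* G} {w₁ : FreeGroup α} {w₂ : FreeGroup β}
    (h : IsAmalgam ιA ιB w₁ w₂) : Countable G := by
  have h1 : (FreeGroup.lift (Sum.elim (fun a => ιA (FreeGroup.of a))
      fun b => ιB (FreeGroup.of b))).range = ⊤ := by
    refine eq_top_iff.2 fun g _ => h.induction (p := fun g => g ∈ MonoidHom.range _) (fun a => ?_)
      (fun b => ?_) (one_mem _) (fun x y hx hy => mul_mem hx hy) (fun x hx => inv_mem hx) g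
    · exact ⟨FreeGroup.of (Sum.inl a), by simp⟩
    · exact ⟨FreeGroup.of (Sum.inr b), by simp⟩
  have : Countable (FreeGroup (α ⊕ β)) := Quot.mk_surjective.countable
  exact (MonoidHom.range_eq_top.1 h1).countable

instance : Countable (FreeAmalgam w₁ w₂) := FreeAmalgam.isAmalgam.countable

theorem cyclicMaps_injective (hw₁ : w₁ ≠ 1) (hw₂ : w₂ ≠ 1) (b : Bool) :
    Function.Injective (cyclicMaps w₁ w₂ b) := by
  cases b
  · exact (injective_iff_map_eq_one _).2 fun k hk =>
      (IsMulTorsionFree.zpow_eq_one_iff_right hw₁).1 hk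
  · exact (injective_iff_map_eq_one _).2 fun k hk =>
      (IsMulTorsionFree.zpow_eq_one_iff_right hw₂).1 hk

theorem FreeAmalgam.left_ne_one (hw₁ : w₁ ≠ 1) (hw₂ : w₂ ≠ 1) : FreeAmalgam.left w₁ w₂ w₁ ≠ 1 := by
  rw [FreeAmalgam.left_eq_base]
  intro h
  have := Monoid.PushoutI.base_injective (cyclicMaps_injective hw₁ hw₂)
    (h.trans (map_one (Monoid.PushoutI.base (cyclicMaps w₁ w₂))).symm)
  exact absurd this (by decide)

theorem FreeAmalgam.nonempty_leftOrder (hw₁ : w₁ ≠ 1) (hw₂ : w₂ ≠ 1) :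
    Nonempty (LeftOrder (FreeAmalgam w₁ w₂)) := by
  obtain ⟨ρ₁, h1, h1'⟩ := FreeGroup.exists_free_hom_eq_shiftQ hw₁
  obtain ⟨ρ₂, h2, h2'⟩ := FreeGroup.exists_free_hom_eq_shiftQ hw₂
  let ρ : ∀ b : Bool, FreeGroup (Fin (bif b then m else n)) →* (ℚ ≃o ℚ)
    | false => ρ₁
    | true => ρ₂
  refine LeftOrder.nonempty_of_residual fun g hg =>
    Monoid.PushoutI.exists_hom_apply_ne (cyclicMaps w₁ w₂) (cyclicMaps_injective hw₁ hw₂) ρ ?_ ?_ hg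
  · rintro (_ | _)
    · change ρ₁ (w₁ ^ (1 : ℤ)) = _
      rw [zpow_one, h1]
    · change ρ₂ (w₂ ^ (1 : ℤ)) = _
      rw [zpow_one, h2]
  · rintro (_ | _)
    · exact h1'
    · exact h2'

/-- The free product of two free groups is a free group on the union of the bases. -/
theorem FreeAmalgam.exists_mulEquiv_freeGroup :
    Nonempty (FreeAmalgam (1 : FreeGroup (Fin n)) (1 : FreeGroup (Fin m)) ≃*
      FreeGroup (Fin n ⊕ Fin m)) := by
  have hG := FreeAmalgam.isAmalgam (w₁ := (1 : FreeGroup (Fin n))) (w₂ := (1 : FreeGroup (Fin m)))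
  obtain ⟨r, hr1, hr2⟩ := hG.lift (FreeGroup.map (Sum.inl : Fin n → Fin n ⊕ Fin m))
    (FreeGroup.map Sum.inr) (by rw [map_one, map_one])
  let i : FreeGroup (Fin n ⊕ Fin m) →*
      FreeAmalgam (1 : FreeGroup (Fin n)) (1 : FreeGroup (Fin m)) :=
    FreeGroup.lift (Sum.elim (fun a => FreeAmalgam.left 1 1 (FreeGroup.of a))
      fun b => FreeAmalgam.right 1 1 (FreeGroup.of b))
  refine ⟨MonoidHom.toMulEquiv r i ?_ ?_⟩
  · refine MonoidHom.ext fun g => ?_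
    refine hG.induction (p := fun g => i (r g) = g) (fun a => ?_) (fun b => ?_) (by simp)
      (fun x y hx hy => by rw [map_mul, map_mul, hx, hy])
      (fun x hx => by rw [map_inv, map_inv, hx]) g
    · simp [hr1, i]
    · simp [hr2, i]
  · ext1 a
    rcases a with a | b
    · simp [i, hr1]
    · simp [i, hr2]

/-- A free group is an amalgam of itself with an infinite cyclic group along a basis element. -/
theorem isAmalgam_mulEquiv_freeGroup {α G : Type*} [Group G] (e : FreeGroup α ≃* G) (a : α) :
    IsAmalgam e.toMonoidHom (FreeGroup.lift fun _ : Unit => e (FreeGroup.of a)) (FreeGroup.of a)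
      (FreeGroup.of ()) where
  comm := by simp
  gen := by
    rw [MonoidHom.range_eq_top.2 e.surjective, top_sup_eq]
  lift f g hfg := by
    refine ⟨f.comp e.symm.toMonoidHom, fun u => by simp, fun u => ?_⟩
    rw [← MonoidHom.comp_apply]
    congr 1
    ext1
    simp [hfg]

end FreeAmalgam

theorem mainTheorem2 (n m : ℕ) (hn : 2 ≤ n) (hm : 1 ≤ m)
    (w₁ : FreeGroup (Fin n)) (w₂ : FreeGroup (Fin m)) (hw : w₁ = 1 ↔ w₂ = 1) :
    (∀ P : LeftOrder (FreeAmalgam w₁ w₂), ¬ IsOpen ({P} : Set (LeftOrder (FreeAmalgam w₁ w₂)))) ∧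
      CompactSpace (LeftOrder (FreeAmalgam w₁ w₂)) ∧
      TopologicalSpace.MetrizableSpace (LeftOrder (FreeAmalgam w₁ w₂)) ∧
      TotallyDisconnectedSpace (LeftOrder (FreeAmalgam w₁ w₂)) ∧
      Nonempty (LeftOrder (FreeAmalgam w₁ w₂) ≃ₜ cantorSet) := by
  have hne : (⟨0, by omega⟩ : Fin n) ≠ ⟨1, by omega⟩ := by simp
  have hmain : Nonempty (LeftOrder (FreeAmalgam w₁ w₂)) ∧ ∀ (P : LeftOrder (FreeAmalgam w₁ w₂))
      (S : Finset (FreeAmalgam w₁ w₂)), (∀ g ∈ S, P.lt 1 g) →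
        ∃ Q : LeftOrder (FreeAmalgam w₁ w₂), (∀ g ∈ S, Q.lt 1 g) ∧ Q ≠ P := by
    by_cases hw₁ : w₁ = 1
    · have hw₂ := hw.1 hw₁
      subst hw₁ hw₂
      obtain ⟨e⟩ := FreeAmalgam.exists_mulEquiv_freeGroup (n := n) (m := m)
      refine ⟨LeftOrder.nonempty_of_residual fun g hg => ?_, fun P S hS => ?_⟩
      · obtain ⟨ρ, hρ⟩ := FreeGroup.exists_hom_eq_shiftQ (w := e g) (by simpa using hg)
        exact ⟨ρ.comp e.toMonoidHom, 0, by simp [hρ]⟩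
      · obtain ⟨φ, a₀, ha₀, hφ⟩ := FreeGroup.exists_hom_int (Sum.inl_injective.ne hne)
          (FreeGroup.of (Sum.inl ⟨0, by omega⟩ : Fin n ⊕ Fin m))
        exact (isAmalgam_mulEquiv_freeGroup e.symm _).exists_ne_of_finset (FreeGroup.of_ne_one _)
          (FreeGroup.of_ne_one _) (by simp [FreeGroup.of_ne_one]) φ ha₀ hφ P S hS
    · have hw₂ : w₂ ≠ 1 := mt hw.2 hw₁
      obtain ⟨φ, a₀, ha₀, hφ⟩ := FreeGroup.exists_hom_int hne w₁
      exact ⟨FreeAmalgam.nonempty_leftOrder hw₁ hw₂, fun P S hS =>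
        FreeAmalgam.isAmalgam.exists_ne_of_finset hw₁ hw₂ (FreeAmalgam.left_ne_one hw₁ hw₂) φ ha₀ hφ
          P S hS⟩
  obtain ⟨hnonempty, hpert⟩ := hmain
  have hiso : ∀ P : LeftOrder (FreeAmalgam w₁ w₂), ¬ IsOpen ({P} : Set (LeftOrder _)) := by
    intro P hP
    obtain ⟨S, hS, hS'⟩ := LeftOrder.exists_finset_of_isOpen hP
    obtain ⟨Q, hQ, hne'⟩ := hpert P S hS
    exact hne' (hS' Q hQ)
  obtain ⟨e, he⟩ := exists_surjective_nat (FreeAmalgam w₁ w₂)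
  have hcode := LeftOrder.isClosedEmbedding_code he
  refine ⟨hiso, hcode.compactSpace, hcode.isEmbedding.metrizableSpace, ?_,
    LeftOrder.nonempty_homeomorph_cantorSet hiso⟩
  exact hcode.isEmbedding.isTotallyDisconnected_range.1
    (isTotallyDisconnected_of_totallyDisconnectedSpace _)
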